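/- **Setting.** Identify $\mathbb R^2$ with $\mathbb C$, let $\Theta_\alpha$ be the rotation of $\mathbb R^2$ by the angle $\alpha$ around the origin, let $S^1=\mathbb R/2\pi\mathbb Z$, and let $\int_{S^1}(\cdots)\,d\alpha$ mean $\frac1{2\pi}\int_0^{2\pi}(\cdots)\,d\alpha$. *Bases.* The Fourier basis $\{\varphi_m\}_{m\in\mathbb Z}$ of $S^1$ is $\varphi_0=1$, $\varphi_m(\beta)=\sqrt2\cos(m\beta)$ for $m>0$, and $\varphi_m(\beta)=\sqrt2\sin(|m|\beta)$ for $m<0$. The Fourier–Bessel basis of the unit disk is indexed by the pairs $k=(n,R)$ with $n\in\mathbb Z$ and $R>0$ a zero of the Bessel function $J_{|n|}$: $$\psi_k(r\cos\theta,r\sin\theta)=c_k\,J_{|n|}(Rr)\,\varphi_n(\theta)\quad(r\le1),\qquad \psi_k=0\ \text{ outside the disk},$$ with $c_k>0$ such that $\int\psi_k^2=\pi$; $\mu_k=R^2$ is the corresponding eigenvalue of the Dirichlet Laplacian on the unit disk. Put $\psi_{j,k}(v)=2^{-2j}\psi_k(2^{-j}v)$. *Network.* A RotDCF Net has $M_l\ge1$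 channels in layer $l\ge0$, a nonlinearity $\sigma:\mathbb R\to\mathbb R$, scales $j_l\in\mathbb R$, biases $b^{(l)}(\lambda)\in\mathbb R$, and filters with real coefficients $$W^{(1)}_{\lambda',\lambda}(v)=\sum_k a^{(1)}_{\lambda',\lambda}(k)\,\psi_{j_1,k}(v),\qquad W^{(l)}_{\lambda',\lambda}(v,\beta)=\sum_k\sum_m a^{(l)}_{\lambda',\lambda}(k,m)\,\psi_{j_l,k}(v)\,\varphi_m(\beta)\quad(l>1),$$ where the sums may be finite or infinite and are taken in $L^2$. For an input $x^{(0)}(u,\lambda)$, $u\in\mathbb R^2$, $\lambda\in[M_0]=\{1,\dots,M_0\}$, the outputs $x^{(l)}=x^{(l)}[x^{(0)}]$ are, for $u\in\mathbb R^2$, $\alpha\in S^1$, $\lambda\in[M_l]$, $$x^{(1)}(u,\alpha,\lambda)=\sigma\Big(\sum_{\lambda'=1}^{M_0}\int_{\mathbb R^2}x^{(0)}(u+v',\lambda')\,W^{(1)}_{\lambda',\lambda}(\Theta_\alpha v')\,dv'+b^{(1)}(\lambda)\Big),$$ $$x^{(l)}(u,\alpha,\lambda)=\sigma\Big(\sum_{\lambda'=1}^{M_{l-1}}\int_{S^1}\int_{\mathbb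 R^2}x^{(l-1)}(u+v',\alpha',\lambda')\,W^{(l)}_{\lambda',\lambda}(\Theta_\alpha v',\alpha'-\alpha)\,dv'\,d\alpha'+b^{(l)}(\lambda)\Big),\quad l>1.$$ *Norms.* Let $\|a^{(1)}_{\lambda',\lambda}\|_{\rm FB}^2=\sum_k\mu_k\,a^{(1)}_{\lambda',\lambda}(k)^2$ and $\|a^{(l)}_{\lambda',\lambda}\|_{\rm FB}^2=\sum_{k,m}\mu_k\,a^{(l)}_{\lambda',\lambda}(k,m)^2$ for $l>1$, and $$A_l=\pi\max\Big\{\sup_\lambda\sum_{\lambda'=1}^{M_{l-1}}\|a^{(l)}_{\lambda',\lambda}\|_{\rm FB},\ \sup_{\lambda'}\frac{M_{l-1}}{M_l}\sum_{\lambda=1}^{M_l}\|a^{(l)}_{\lambda',\lambda}\|_{\rm FB}\Big\}.$$ Fix a measurable $\Omega\subset\mathbb R^2$ with $0<|\Omega|<\infty$ (the image domain, used only to normalise) and put $$\|x^{(0)}\|^2=\frac1{M_0}\sum_\lambda\frac1{|\Omega|}\int_{\mathbb R^2}x^{(0)}(u,\lambda)^2\,du,\qquad \|x^{(l)}\|^2=\frac1{M_l}\sum_\lambda\frac1{|\Omega|}\int_{\mathbb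 R^2}\int_{S^1}x^{(l)}(u,\alpha,\lambda)^2\,d\alpha\,du\quad(l\ge1).$$ *Actions.* For the rotation $\rho u=u_0+\Theta_t(u-u_0)$ by the angle $t$ around $u_0\in\mathbb R^2$, and for $\tau:\mathbb R^2\to\mathbb R^2$ of class $C^2$, let $$D_\rho x^{(0)}(u,\lambda)=x^{(0)}(\rho u,\lambda),\quad T_\rho x^{(l)}(u,\alpha,\lambda)=x^{(l)}(\rho u,\alpha-t,\lambda),$$ $$D_\tau x^{(0)}(u,\lambda)=x^{(0)}(u-\tau(u),\lambda),\quad D_\tau x^{(l)}(u,\alpha,\lambda)=x^{(l)}(u-\tau(u),\alpha,\lambda).$$ **Proposition 3.3.** Consider a RotDCF Net with $L$ layers and assume - (A1) $\sigma$ is non-expansive: $|\sigma(s)-\sigma(s')|\le|s-s'|$ for all $s,s'\in\mathbb R$; - (A2) $A_l\le1$ for $l=1,\dots,L$; - (A3) $|\nabla\tau|_\infty:=\sup_u\|\nabla\tau(u)\|<\frac15$, with the operator norm. Then, with $c_1=4$, for every rotation $\rho$, every $x^{(0)}$ whose channels are in $L^2(\mathbb R^2)$, and every $l=1,\dots,L$,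 $$\big\|x^{(l)}[D_\rho\circ D_\tau x^{(0)}]-T_\rho\circ D_\tau\,x^{(l)}[x^{(0)}]\big\|\le 2c_1\,l\,|\nabla\tau|_\infty\,\|x^{(0)}\|.$$ -/

import Mathlib

open MeasureTheory Filter Topology
open scoped ENNReal

namespace RotDCF

noncomputable section

/-! ### The plane, the circle and rotations

The plane `ℝ²` is modelled by `ℂ`, which carries the Euclidean norm and Lebesgue measure. -/

instance instFactTwoPiPos : Fact ((0 : ℝ) < 2 * Real.pi) := ⟨Real.two_pi_pos⟩

/-- The circle `S¹ = ℝ / 2πℤ`, i.e. the group `SO(2)` parametrised by the rotation angle. -/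
abbrev S1 : Type := AddCircle (2 * Real.pi)

/-- The normalised measure `(1 / 2π) dα` on the circle. -/
abbrev circleMeasure : Measure S1 := AddCircle.haarAddCircle

/-- The measure `du dα` on `ℝ² × S¹`, the circle having total mass `1`. -/
abbrev jointMeasure : Measure (ℂ × S1) := (volume : Measure ℂ).prod circleMeasure

/-- `Θ_t`, the rotation of the plane by the angle `t` around the origin: `Θ_t v = e^{it} v`. -/
def rot (t : S1) (v : ℂ) : ℂ := (AddCircle.toCircle t : ℂ) * v

/-- `ρ_{u₀,t}`, the rotation of the plane by the angle `t` around the point `u₀`. -/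
def rotAbout (u₀ : ℂ) (t : S1) (u : ℂ) : ℂ := u₀ + rot t (u - u₀)

/-! ### Fourier and Fourier-Bessel bases (real versions) -/

/-- The Bessel function of the first kind `J_n` of order `n ∈ ℕ`. -/
def besselJ (n : ℕ) (x : ℝ) : ℝ :=
  ∑' i : ℕ, (-1 : ℝ) ^ i / ((i.factorial : ℝ) * ((i + n).factorial : ℝ)) * (x / 2) ^ (2 * i + n)

/-- The real Fourier basis of the circle: `1` for `m = 0`, `√2 cos (m β)` for `m > 0` and
`√2 sin (|m| β)` for `m < 0`. It is orthonormal for the normalised measure. -/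
def circleBasis (m : ℤ) (β : S1) : ℝ :=
  if m = 0 then 1
  else if 0 < m then √2 * (fourier m β).re
  else √2 * (fourier (-m) β).im

/-- Indices `k = (n, R)` of the Fourier-Bessel basis: an integer `n` selecting the angular
function, and a positive zero `R` of the Bessel function `J_{|n|}`. -/
def FBIndex : Type := {p : ℤ × ℝ // 0 < p.2 ∧ besselJ p.1.natAbs p.2 = 0}

/-- The eigenvalue `μ_k = R²` of the Dirichlet Laplacian on the unit disk that belongs to the
Fourier-Bessel function of index `k = (n, R)`. -/
def fbEigenvalue (k : FBIndex) : ℝ := k.1.2 ^ 2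

/-- The Fourier-Bessel function of index `k = (n, R)` before normalisation: in polar coordinates
`J_{|n|}(R r) · (angular function n)(θ)` on the unit disk, and `0` outside. -/
def fbRaw (k : FBIndex) (v : ℂ) : ℝ :=
  if ‖v‖ ≤ 1 then besselJ k.1.1.natAbs (k.1.2 * ‖v‖) * circleBasis k.1.1 ((v.arg : ℝ) : S1)
  else 0

/-- The Fourier-Bessel basis function `ψ_k` of the unit disk, normalised so that its mean square
over the disk is `1`, i.e. `∫ ψ_k² = π`. -/
def fbBasis (k : FBIndex) (v : ℂ) : ℝ :=
  √(Real.pi / ∫ w : ℂ, fbRaw k w ^ 2) * fbRaw k v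

/-- `ψ_{j,k}(v) = 2^{-2j} ψ_k(2^{-j} v)`, the basis function rescaled to the disk of
radius `2^j`. -/
def fbScaled (j : ℝ) (k : FBIndex) (v : ℂ) : ℝ :=
  (2 : ℝ) ^ (-2 * j) * fbBasis k ((((2 : ℝ) ^ (-j) : ℝ) : ℂ) * v)

/-- `W = ∑_k a(k) ψ_{j,k}`, the (finite or infinite) sum being taken in `L²(ℝ²)`. -/
def IsPlaneExpansion (j : ℝ) (a : FBIndex → ℝ) (W : ℂ → ℝ) : Prop :=
  MemLp W 2 volume ∧
    Tendsto (fun s : Finset FBIndex =>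
      eLpNorm (fun v => W v - ∑ k ∈ s, a k * fbScaled j k v) 2 volume) atTop (𝓝 0)

/-- `W(v, β) = ∑_k ∑_m a(k, m) ψ_{j,k}(v) φ_m(β)`, the (finite or infinite) sum being taken
in `L²(ℝ² × S¹)`. -/
def IsJointExpansion (j : ℝ) (a : FBIndex → ℤ → ℝ) (W : ℂ → S1 → ℝ) : Prop :=
  MemLp (fun p : ℂ × S1 => W p.1 p.2) 2 jointMeasure ∧
    Tendsto (fun s : Finset (FBIndex × ℤ) =>
      eLpNorm (fun p : ℂ × S1 => W p.1 p.2 -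
        ∑ q ∈ s, a q.1 q.2 * (fbScaled j q.1 p.1 * circleBasis q.2 p.2)) 2 jointMeasure)
      atTop (𝓝 0)

/-- `‖a‖_FB` for first-layer coefficients (`∞` if the series diverges). -/
def fbNormPlane (a : FBIndex → ℝ) : ℝ≥0∞ :=
  (∑' k, ENNReal.ofReal (fbEigenvalue k * a k ^ 2)) ^ (1 / 2 : ℝ)

/-- `‖a‖_FB` for the coefficients of a joint layer (`∞` if the series diverges). -/
def fbNormJoint (a : FBIndex → ℤ → ℝ) : ℝ≥0∞ :=
  (∑' k, ∑' m, ENNReal.ofReal (fbEigenvalue k * a k m ^ 2)) ^ (1 / 2 : ℝ)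

/-- `π · max { sup_λ ∑_λ' c(λ', λ), sup_λ' (M' / M) ∑_λ c(λ', λ) }` for an array `c` indexed by
`λ' ∈ [M']` and `λ ∈ [M]`. -/
def filterBound {M' M : ℕ} (c : Fin M' → Fin M → ℝ≥0∞) : ℝ≥0∞ :=
  ENNReal.ofReal Real.pi *
    max (⨆ i, ∑ i', c i' i) (⨆ i', (M' : ℝ≥0∞) / (M : ℝ≥0∞) * ∑ i, c i' i)

/-! ### The network -/

/-- A RotDCF Net. Layer `0` is the input, layer `1` the first convolutional layer; the fields
`j`, `a`, `W`, `b` at `l` belong to layer `l + 2`. Only finitely many layers matter for any given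
output; a network of finite depth is prolonged arbitrarily. -/
structure RotDCFNet where
  /-- the nonlinearity -/
  σ : ℝ → ℝ
  /-- `M l` is the number of unstructured channels of layer `l` -/
  M : ℕ → ℕ
  M_pos : ∀ l, 0 < M l
  /-- scale, coefficients, filters and biases of the first layer -/
  j₁ : ℝ
  a₁ : Fin (M 0) → Fin (M 1) → FBIndex → ℝ
  W₁ : Fin (M 0) → Fin (M 1) → ℂ → ℝ
  b₁ : Fin (M 1) → ℝ
  expansion₁ : ∀ i' i, IsPlaneExpansion j₁ (a₁ i' i) (W₁ i' i)
  /-- scale, coefficients, filters and biases of layer `l + 2` -/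
  j : ℕ → ℝ
  a : ∀ l, Fin (M (l + 1)) → Fin (M (l + 2)) → FBIndex → ℤ → ℝ
  W : ∀ l, Fin (M (l + 1)) → Fin (M (l + 2)) → ℂ → S1 → ℝ
  b : ∀ l, Fin (M (l + 2)) → ℝ
  expansion : ∀ l i' i, IsJointExpansion (j l) (a l i' i) (W l i' i)

/-- An input image `x⁽⁰⁾(u, λ)` with `M` channels. -/
abbrev Image (M : ℕ) : Type := ℂ → Fin M → ℝ

/-- A layer output `x⁽ˡ⁾(u, α, λ)`, `l ≥ 1`, with `M` unstructured channels. -/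
abbrev Feature (M : ℕ) : Type := ℂ → S1 → Fin M → ℝ

namespace RotDCFNet

/-- The first layer. -/
def firstLayer (N : RotDCFNet) (x : Image (N.M 0)) : Feature (N.M 1) := fun u α i =>
  N.σ (∑ i', (∫ v : ℂ, x (u + v) i' * N.W₁ i' i (rot α v)) + N.b₁ i)

/-- Layer `l + 2`: the joint convolution over `ℝ² × S¹`, applied to an output of layer `l + 1`. -/
def jointLayer (N : RotDCFNet) (l : ℕ) (x : Feature (N.M (l + 1))) : Feature (N.M (l + 2)) :=
  fun u α i =>
    N.σ (∑ i', (∫ p : ℂ × S1, x (u + p.1) p.2 i' * N.W l i' i (rot α p.1) (p.2 - α) ∂jointMeasure)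
      + N.b l i)

/-- `N.output x₀ l` is the output `x⁽ˡ⁺¹⁾[x₀]` of layer `l + 1` from the input `x₀`. -/
def output (N : RotDCFNet) (x₀ : Image (N.M 0)) : (l : ℕ) → Feature (N.M (l + 1))
  | 0 => N.firstLayer x₀
  | l + 1 => N.jointLayer l (N.output x₀ l)

/-- `N.A l` is the constant `A_{l+1}` of layer `l + 1`. -/
def A (N : RotDCFNet) : ℕ → ℝ≥0∞
  | 0 => filterBound fun i' i => fbNormPlane (N.a₁ i' i)
  | l + 1 => filterBound fun i' i => fbNormJoint (N.a l i' i)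

end RotDCFNet

/-! ### Norms -/

/-- `‖x⁽⁰⁾‖`, where `‖x‖² = (1/M) ∑_λ (1/|Ω|) ∫ x(u, λ)² du`. -/
def imageNorm (Ω : Set ℂ) {M : ℕ} (x : Image M) : ℝ≥0∞ :=
  ((M : ℝ≥0∞)⁻¹ * ∑ i, (volume Ω)⁻¹ * ∫⁻ u : ℂ, ‖x u i‖ₑ ^ 2) ^ (1 / 2 : ℝ)

/-- `‖x⁽ˡ⁾‖`, where `‖x‖² = (1/M) ∑_λ (1/|Ω|) ∫∫ x(u, α, λ)² du dα`. -/
def featureNorm (Ω : Set ℂ) {M : ℕ} (x : Feature M) : ℝ≥0∞ :=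
  ((M : ℝ≥0∞)⁻¹ * ∑ i, (volume Ω)⁻¹ * ∫⁻ p : ℂ × S1, ‖x p.1 p.2 i‖ₑ ^ 2 ∂jointMeasure)
    ^ (1 / 2 : ℝ)

/-! ### Actions on images and features -/

/-- `D_ρ` on images, for `ρ = ρ_{u₀,t}`. -/
def rotateImage (u₀ : ℂ) (t : S1) {M : ℕ} (x : Image M) : Image M :=
  fun u i => x (rotAbout u₀ t u) i

/-- `T_ρ` on layer outputs, for `ρ = ρ_{u₀,t}`. -/
def rotateFeature (u₀ : ℂ) (t : S1) {M : ℕ} (x : Feature M) : Feature M :=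
  fun u α i => x (rotAbout u₀ t u) (α - t) i

/-- `D_τ` on images. -/
def deformImage (τ : ℂ → ℂ) {M : ℕ} (x : Image M) : Image M :=
  fun u i => x (u - τ u) i

/-- `D_τ` on layer outputs, acting on the space variable only. -/
def deformFeature (τ : ℂ → ℂ) {M : ℕ} (x : Feature M) : Feature M :=
  fun u α i => x (u - τ u) α i

/-- `|∇τ|_∞ = sup_u ‖∇τ(u)‖`, with the operator norm of the real differential. -/
def gradSup (τ : ℂ → ℂ) : ℝ≥0∞ := ⨆ u, ‖fderiv ℝ τ u‖ₑ

end

end RotDCF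

/-! A layer is a group convolution followed by a pointwise map. It commutes exactly with rotations,
is non-expansive, and commutes with `D_τ` up to an error of at most `8ε` times the centred norm of
its input, where `ε = |∇τ|_∞`. Telescoping over the layers gives the factor `8 l ε = 2c₁ l ε`.

Analytically, everything rests on `π‖a‖_FB` controlling both the `L¹` norm of a filter and the `L¹`
effect of deforming it. The Fourier-Bessel functions are Dirichlet eigenfunctions of the disk, so
Green's identity and orthogonality bound the squared `L²` norm of the gradient of a finite expansion
by `π ∑ μ_k a²` (`integral_gradDot_fbSum_le`). Poincaré's inequality with constant `1` gives the
same bound for the function itself, and Cauchy-Schwarz on a set of measure `π` turns both into `L¹`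
bounds by `π‖a‖_FB`. Since the expansions vanish on the circle, a deformed difference is an integral
of the gradient over the disk along a segment. There the displacement is relative, `|τ z - τ u| ≤ ε
|z - u|`, while `|z - u|` is comparable to the filter radius, so the scale drops out
(`lintegral_enorm_indicator_deform_sub_le`). Infinite expansions follow by `L¹` approximation
(`FilterBound.of_approx`).

After the change of variables `q ↦ q - τ(q)`, the commutator of a convolution with `D_τ` is an
integral operator whose kernel has small row and column integrals. Schur's test over position and
angle bounds it (`FilterBound.eLpNorm_commutator_le`), and a second Schur test over the channels
uses `A_l ≤ 1` (`featureNorm_le_of_channels`).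

Because of the biases, a layer output need not be in `L²(ℝ² × S¹)`. The response to the zero input
is however constant in space and angle, hence fixed by both actions. Outputs are therefore measured
relative to these constants: by non-expansiveness their distance to them never exceeds `‖x⁽⁰⁾‖`, and
the commutator of each convolution vanishes on constants. One layer is treated in
`FilterBank.equivariance_step`. -/

namespace RotDCF

/-! ### Bessel functions as power series -/

/-- The coefficients of the entire function `h_n` with `J_n(x) = (x/2)^n h_n(x²/4)`. -/
noncomputable def besselCoeff (n i : ℕ) : ℝ :=
  (-1 : ℝ) ^ i / ((i.factorial : ℝ) * ((i + n).factorial : ℝ))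

/-- The entire function `h_n` with `J_n(x) = (x/2)^n h_n(x²/4)`. -/
noncomputable def besselEntire (n : ℕ) (t : ℝ) : ℝ := ∑' i : ℕ, besselCoeff n i * t ^ i

lemma abs_besselCoeff_le (n i : ℕ) : |besselCoeff n i| ≤ (i.factorial : ℝ)⁻¹ := by
  unfold besselCoeff
  rw [abs_div, abs_pow, abs_neg, abs_one, one_pow, abs_of_nonneg (by positivity), one_div]
  apply inv_anti₀ (by positivity)
  have : (1 : ℝ) ≤ ((i + n).factorial : ℝ) := by exact_mod_cast Nat.succ_le_of_lt (Nat.factorial_pos _)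
  nlinarith [(by positivity : (0 : ℝ) ≤ (i.factorial : ℝ))]

lemma summable_besselCoeff (n : ℕ) (t : ℝ) : Summable fun i => besselCoeff n i * t ^ i := by
  refine Summable.of_norm_bounded (Real.summable_pow_div_factorial |t|) fun i => ?_
  rw [norm_mul, norm_pow, Real.norm_eq_abs, Real.norm_eq_abs, div_eq_inv_mul]
  exact mul_le_mul_of_nonneg_right (abs_besselCoeff_le n i) (by positivity)

/-- Termwise form of `h_n' = -h_{n+1}`, which keeps all derivatives within the family `h_n`. -/
lemma besselCoeff_succ (n i : ℕ) :
    besselCoeff n (i + 1) * ((i : ℝ) + 1) = -besselCoeff (n + 1) i := by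
  unfold besselCoeff
  rw [show i + 1 + n = i + (n + 1) by ring, Nat.factorial_succ i]
  have h1 : (i.factorial : ℝ) ≠ 0 := by positivity
  have h2 : ((i + (n + 1)).factorial : ℝ) ≠ 0 := by positivity
  have h3 : (i : ℝ) + 1 ≠ 0 := by positivity
  push_cast
  field_simp
  ring

lemma besselJ_eq (n : ℕ) (x : ℝ) : besselJ n x = (x / 2) ^ n * besselEntire n (x ^ 2 / 4) := by
  unfold besselJ besselEntire besselCoeff
  rw [← tsum_mul_left]
  congr 1; ext i
  rw [pow_add, pow_mul, show (x / 2) ^ 2 = x ^ 2 / 4 by ring]; ring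

lemma hasDerivAt_besselEntire (n : ℕ) (t : ℝ) :
    HasDerivAt (besselEntire n) (-besselEntire (n + 1) t) t := by
  have hsum : ∑' i : ℕ, besselCoeff n i * ((i : ℝ) * t ^ (i - 1)) = -besselEntire (n + 1) t := by
    have hs : Summable fun i : ℕ => besselCoeff n (i + 1) * (((i + 1 : ℕ) : ℝ) * t ^ i) := by
      refine ((summable_besselCoeff (n + 1) t).neg).congr fun i => ?_
      rw [← neg_mul, ← besselCoeff_succ]; push_cast; ring
    rw [tsum_eq_zero_add' (by simpa using hs)]
    unfold besselEntire
    rw [← tsum_neg]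
    simp only [Nat.cast_zero, zero_mul, mul_zero, zero_add, Nat.add_sub_cancel]
    congr 1; ext i
    rw [← neg_mul, ← besselCoeff_succ]; push_cast; ring
  rw [← hsum]
  have hu : Summable fun i : ℕ => (i : ℝ) * (|t| + 1) ^ (i - 1) / (i.factorial : ℝ) := by
    rw [← summable_nat_add_iff 1]
    refine (Real.summable_pow_div_factorial (|t| + 1)).congr fun i => ?_
    rw [Nat.factorial_succ, Nat.add_sub_cancel]
    have h1 : (i.factorial : ℝ) ≠ 0 := by positivity
    have h3 : (i : ℝ) + 1 ≠ 0 := by positivity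
    push_cast; field_simp
  refine hasDerivAt_tsum_of_isPreconnected (t := Metric.ball 0 (|t| + 1)) (y₀ := t) hu
    Metric.isOpen_ball (convex_ball _ _).isPreconnected
    (fun i y _ => (hasDerivAt_pow i y).const_mul _) (fun i y hy => ?_) (by simp)
    (summable_besselCoeff n t) (by simp)
  rw [norm_mul, norm_mul, norm_pow, div_eq_inv_mul, Real.norm_natCast]
  have hy' : ‖y‖ ≤ |t| + 1 := by simpa using (Metric.mem_ball.mp hy).le
  gcongr
  exact abs_besselCoeff_le n i

lemma contDiff_besselEntire (m n : ℕ) : ContDiff ℝ m (besselEntire n) := by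
  induction m generalizing n with
  | zero =>
    exact contDiff_zero.mpr (continuous_iff_continuousAt.mpr fun t =>
      (hasDerivAt_besselEntire n t).continuousAt)
  | succ m ih =>
    have : ((m + 1 : ℕ) : WithTop ℕ∞) = (m : WithTop ℕ∞) + 1 := by norm_cast
    rw [this, contDiff_succ_iff_deriv]
    refine ⟨fun t => (hasDerivAt_besselEntire n t).differentiableAt, by simp, ?_⟩
    rw [show deriv (besselEntire n) = fun t => -besselEntire (n + 1) t from
      funext fun t => (hasDerivAt_besselEntire n t).deriv]
    exact (ih (n + 1)).neg

/-- Since `h_n' = -h_{n+1}`, this is Bessel's equation `t h'' + (n+1) h' + h = 0` for `h = h_n`. -/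
lemma besselEntire_recurrence (n : ℕ) (t : ℝ) :
    t * besselEntire (n + 2) t - (n + 1) * besselEntire (n + 1) t + besselEntire n t = 0 := by
  have hc (i : ℕ) : besselCoeff n i - ((n : ℝ) + 1) * besselCoeff (n + 1) i
      = (i : ℝ) * besselCoeff (n + 1) i := by
    unfold besselCoeff
    rw [show i + (n + 1) = i + n + 1 by ring, Nat.factorial_succ (i + n)]
    have h1 : (i.factorial : ℝ) ≠ 0 := by positivity
    have h2 : ((i + n).factorial : ℝ) ≠ 0 := by positivity
    have h3 : (i : ℝ) + n + 1 ≠ 0 := by positivity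
    push_cast
    field_simp
    ring
  have h1 : besselEntire n t - (n + 1) * besselEntire (n + 1) t
      = ∑' i : ℕ, (i : ℝ) * besselCoeff (n + 1) i * t ^ i := by
    unfold besselEntire
    rw [← tsum_mul_left, ← Summable.tsum_sub (summable_besselCoeff n t)
      ((summable_besselCoeff (n + 1) t).mul_left _)]
    congr 1; ext i
    rw [← hc]; ring
  have hi (i : ℕ) : ((i + 1 : ℕ) : ℝ) * besselCoeff (n + 1) (i + 1) * t ^ (i + 1)
      = -(t * (besselCoeff (n + 2) i * t ^ i)) := by
    have := besselCoeff_succ (n + 1) i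
    rw [show n + 1 + 1 = n + 2 by ring] at this
    push_cast
    linear_combination t ^ (i + 1) * this
  have h2 : ∑' i : ℕ, (i : ℝ) * besselCoeff (n + 1) i * t ^ i = -(t * besselEntire (n + 2) t) := by
    rw [tsum_eq_zero_add']
    · simp only [hi]
      unfold besselEntire
      rw [tsum_neg, tsum_mul_left]; simp
    · simp only [hi]
      exact ((summable_besselCoeff (n + 2) t).mul_left t).neg
  linarith

/-! ### Real Fourier basis of the circle -/

/-- The complex amplitude of the angular function of index `n`. -/
noncomputable def angularCoeff (n : ℤ) : ℂ :=
  if n = 0 then 1 else if 0 < n then (√2 : ℝ) else -((√2 : ℝ) * Complex.I)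

/-- A single character of frequency `|n|` covers the cosine and sine cases, and combines with
`r^|n|` into a power of the complex variable. -/
lemma circleBasis_eq_re (n : ℤ) (β : S1) :
    circleBasis n β = (angularCoeff n * fourier (n.natAbs : ℤ) β).re := by
  unfold circleBasis angularCoeff
  split_ifs with h0 h1
  · simp [h0]
  · rw [Int.natAbs_of_nonneg h1.le]; simp
  · rw [show (n.natAbs : ℤ) = -n by omega]; simp

lemma continuous_circleBasis (n : ℤ) : Continuous (circleBasis n) := by
  rw [show circleBasis n = _ from funext (circleBasis_eq_re n)]
  fun_prop

lemma integral_fourier (m : ℤ) :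
    ∫ β : S1, (fourier m β : ℂ) ∂circleMeasure = if m = 0 then 1 else 0 := by
  have h := fourierCoeff_fourier (T := 2 * Real.pi) m
  have h0 := congrFun h 0
  simp only [fourierCoeff] at h0
  rw [show (∫ β : S1, (fourier m β : ℂ) ∂circleMeasure) = _ from by simpa using h0]
  by_cases hm : m = 0
  · subst hm; simp
  · simp [hm, Ne.symm hm]

lemma integral_circleBasis_mul (m m' : ℤ) :
    ∫ β : S1, circleBasis m β * circleBasis m' β ∂circleMeasure = if m = m' then 1 else 0 := by
  set w := angularCoeff m with hw
  set w' := angularCoeff m' with hw'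
  -- `Re z · Re z' = ½ Re (z z' + z z̄')` leaves only the sum and difference frequencies.
  have key (β : S1) : circleBasis m β * circleBasis m' β =
      (1 / 2 * (w * w' * fourier ((m.natAbs : ℤ) + m'.natAbs) β
        + w * (starRingEnd ℂ) w' * fourier ((m.natAbs : ℤ) - m'.natAbs) β)).re := by
    rw [circleBasis_eq_re, circleBasis_eq_re, sub_eq_add_neg, fourier_add, fourier_add, fourier_neg]
    simp only [← hw, ← hw', Complex.add_re, Complex.mul_re, Complex.mul_im, Complex.conj_re,
      Complex.conj_im]
    norm_num
    ring
  have hint (n : ℤ) : Integrable (fun β : S1 => (fourier n β : ℂ)) circleMeasure :=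
    (map_continuous _).integrable_of_hasCompactSupport (HasCompactSupport.of_compactSpace _)
  simp only [key]
  have hI : Integrable (fun β : S1 => (1 / 2 : ℂ) * (w * w' * fourier ((m.natAbs : ℤ) + m'.natAbs) β
        + w * (starRingEnd ℂ) w' * fourier ((m.natAbs : ℤ) - m'.natAbs) β)) circleMeasure :=
    (((hint _).const_mul _).add ((hint _).const_mul _)).const_mul _
  have := integral_re hI
  simp only [RCLike.re_to_complex] at this
  rw [this, integral_const_mul, integral_add ((hint _).const_mul _) ((hint _).const_mul _),
    integral_const_mul, integral_const_mul, integral_fourier, integral_fourier]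
  have hs2 : (√2 : ℝ) * √2 = 2 := Real.mul_self_sqrt (by norm_num)
  have hzero (a : ℤ) (ha : a = 0) : angularCoeff a = 1 := by simp [angularCoeff, ha]
  have hpos (a : ℤ) (ha : 0 < a) : angularCoeff a = (√2 : ℝ) := by simp [angularCoeff, ha, ha.ne']
  have hneg (a : ℤ) (ha : a < 0) : angularCoeff a = -((√2 : ℝ) * Complex.I) := by
    simp [angularCoeff, ha.not_gt, ha.ne]
  by_cases e : m = m'
  · subst e
    rw [hw', ← hw, if_pos rfl]
    simp only [sub_self, if_true]
    rcases lt_trichotomy m 0 with h | h | h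
    · rw [if_neg (by omega), hw, hneg m h]
      simp
    · rw [if_pos (by omega), hw, hzero m h]
      norm_num
    · rw [if_neg (by omega), hw, hpos m h]
      simp
  · rw [if_neg e, if_neg (by omega)]
    -- If `|m| = |m'|` but `m ≠ m'`, one function is a cosine and the other a sine; the product of
    -- one amplitude with the conjugate of the other is imaginary.
    by_cases h0 : (m.natAbs : ℤ) - m'.natAbs = 0
    · rw [if_pos h0, hw, hw']
      rcases lt_or_ge m 0 with h | h
      · rw [hneg m h, hpos m' (by omega)]; simp
      · rw [hpos m (by omega), hneg m' (by omega)]; simp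
    · rw [if_neg h0]; simp

/-! ### Fourier-Bessel functions as smooth eigenfunctions -/

/-- The smooth function `h_m(c |v|²) Re (w v^n)`. -/
noncomputable def besselBlock (c : ℝ) (m n : ℕ) (w v : ℂ) : ℝ :=
  besselEntire m (c * Complex.normSq v) * (w * v ^ n).re

/-- The smooth extension of the Fourier-Bessel function to the plane. -/
noncomputable def fbSmooth (k : FBIndex) (v : ℂ) : ℝ :=
  √(Real.pi / ∫ w : ℂ, fbRaw k w ^ 2) * (k.1.2 / 2) ^ k.1.1.natAbs *
    besselBlock (k.1.2 ^ 2 / 4) k.1.1.natAbs k.1.1.natAbs (angularCoeff k.1.1) v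

lemma contDiff_normSq (m : WithTop ℕ∞) : ContDiff ℝ m (fun v : ℂ => Complex.normSq v) := by
  simp only [Complex.normSq_eq_norm_sq]
  exact contDiff_norm_sq ℝ

lemma contDiff_besselBlock (c : ℝ) (k m n : ℕ) (w : ℂ) :
    ContDiff ℝ k (besselBlock c m n w) := by
  unfold besselBlock
  refine ((contDiff_besselEntire k m).comp (contDiff_const.mul (contDiff_normSq _))).mul ?_
  exact Complex.reCLM.contDiff.comp (contDiff_const.mul (contDiff_id.pow n))

/-- Differentiating the radial factor raises `m`; differentiating the power lowers `n` and changes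
`w`. Keeping `m`, `n` and `w` independent closes the family under differentiation. The truncated `n
- 1` is harmless, its amplitude being zero when `n = 0`. -/
lemma fderiv_besselBlock (c : ℝ) (m n : ℕ) (w v e : ℂ) :
    fderiv ℝ (besselBlock c m n w) v e =
      -2 * c * (v.re * e.re + v.im * e.im) * besselBlock c (m + 1) n w v
        + besselBlock c m (n - 1) (n * w * e) v := by
  have h1 : HasFDerivAt (fun v : ℂ => c * (v.re * v.re + v.im * v.im))
      (c • ((v.re • Complex.reCLM + v.re • Complex.reCLM)
        + (v.im • Complex.imCLM + v.im • Complex.imCLM))) v := by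
    have hr : HasFDerivAt (fun v : ℂ => v.re) Complex.reCLM v := Complex.reCLM.hasFDerivAt
    have hi : HasFDerivAt (fun v : ℂ => v.im) Complex.imCLM v := Complex.imCLM.hasFDerivAt
    exact ((hr.mul hr).add (hi.mul hi)).const_mul c
  have h2 := (hasDerivAt_besselEntire m (c * Complex.normSq v)).comp_hasFDerivAt_of_eq v h1
    (by rw [Complex.normSq_apply])
  have h3 : HasDerivAt (fun v : ℂ => w * v ^ n) (w * (n * v ^ (n - 1))) v :=
    (hasDerivAt_pow n v).const_mul w
  have h4 := Complex.reCLM.hasFDerivAt.comp v (h3.hasFDerivAt.restrictScalars ℝ)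
  have h5 : HasFDerivAt (besselBlock c m n w) _ v := h2.mul h4
  rw [h5.fderiv]
  simp only [besselBlock, Complex.normSq_apply, Function.comp]
  simp only [add_apply, smul_apply,
    ContinuousLinearMap.comp_apply, Complex.reCLM_apply, Complex.imCLM_apply, smul_eq_mul,
    ContinuousLinearMap.coe_restrictScalars']
  simp only [ContinuousLinearMap.toSpanSingleton_apply, smul_eq_mul]
  rw [show (n : ℂ) * w * e * v ^ (n - 1) = e * (w * (n * v ^ (n - 1))) by ring]
  ring

/-- The Laplacian of a twice differentiable function on the plane. -/
noncomputable def planeLaplacian (f : ℂ → ℝ) (v : ℂ) : ℝ :=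
  fderiv ℝ (fun u => fderiv ℝ f u 1) v 1
    + fderiv ℝ (fun u => fderiv ℝ f u Complex.I) v Complex.I

/-- Three facts combine: `Re (w v^n)` is harmonic (`e1`), Euler's identity for homogeneous functions
evaluates the cross term (`e2`), and the radial factor solves Bessel's equation (`e3`). -/
lemma planeLaplacian_besselBlock (c : ℝ) (n : ℕ) (w v : ℂ) :
    planeLaplacian (besselBlock c n n w) v = -4 * c * besselBlock c n n w v := by
  have hd (m n : ℕ) (w v : ℂ) : HasFDerivAt (besselBlock c m n w)
      (fderiv ℝ (besselBlock c m n w) v) v :=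
    ((contDiff_besselBlock c 1 m n w).differentiable (by simp)).differentiableAt.hasFDerivAt
  unfold planeLaplacian
  simp only [fderiv_besselBlock]
  have hr : HasFDerivAt (fun v : ℂ => v.re) Complex.reCLM v := Complex.reCLM.hasFDerivAt
  have hi : HasFDerivAt (fun v : ℂ => v.im) Complex.imCLM v := Complex.imCLM.hasFDerivAt
  have h1 := ((hr.const_mul (-2 * c)).mul (hd (n + 1) n w v)).add (hd n (n - 1) (n * w * 1) v)
  have h2 := ((hi.const_mul (-2 * c)).mul (hd (n + 1) n w v)).add
    (hd n (n - 1) (n * w * Complex.I) v)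
  simp only [Complex.one_re, Complex.one_im, Complex.I_re, Complex.I_im, mul_one, mul_zero,
    add_zero, zero_add] at h1 ⊢
  erw [h1.fderiv, h2.fderiv]
  simp only [add_apply, smul_apply, smul_eq_mul,
    fderiv_besselBlock, Complex.reCLM_apply, Complex.imCLM_apply, Complex.one_re, Complex.one_im,
    Complex.I_re, Complex.I_im, mul_one, mul_zero, add_zero, zero_add]
  have hrec := besselEntire_recurrence n (c * Complex.normSq v)
  rcases n with _ | n
  · simp only [besselBlock, Nat.cast_zero, zero_mul, mul_zero, Complex.zero_re]
    rw [Complex.normSq_apply] at *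
    push_cast at hrec
    linear_combination 4 * c * (w * v ^ 0).re * hrec
  · have e1 : besselBlock c (n + 1) (n + 1 - 1 - 1) (((n + 1 - 1 : ℕ) : ℂ) *
        (((n + 1 : ℕ) : ℂ) * w * Complex.I) * Complex.I) v =
        - besselBlock c (n + 1) (n + 1 - 1 - 1) (((n + 1 - 1 : ℕ) : ℂ) *
        (((n + 1 : ℕ) : ℂ) * w)) v := by
      unfold besselBlock
      rw [show ((n + 1 - 1 : ℕ) : ℂ) * (((n + 1 : ℕ) : ℂ) * w * Complex.I) * Complex.I
        = - (((n + 1 - 1 : ℕ) : ℂ) * (((n + 1 : ℕ) : ℂ) * w)) by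
          linear_combination ((n + 1 - 1 : ℕ) : ℂ) * (((n + 1 : ℕ) : ℂ) * w) * Complex.I_mul_I]
      simp
      ring
    rw [e1]
    have e2 : v.re * besselBlock c (n + 1 + 1) n (((n + 1 : ℕ) : ℂ) * w) v
        + v.im * besselBlock c (n + 1 + 1) n (((n + 1 : ℕ) : ℂ) * w * Complex.I) v
        = (n + 1) * besselBlock c (n + 1 + 1) (n + 1) w v := by
      unfold besselBlock
      have : w * v ^ (n + 1) = (w * v ^ n) * v := by ring
      rw [this, show ((n + 1 : ℕ) : ℂ) * w * v ^ n = ((n + 1 : ℝ) : ℂ) * (w * v ^ n) by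
        push_cast; ring, show ((n + 1 : ℕ) : ℂ) * w * Complex.I * v ^ n
          = ((n + 1 : ℝ) : ℂ) * (w * v ^ n * Complex.I) by push_cast; ring,
        Complex.re_ofReal_mul, Complex.re_ofReal_mul, Complex.mul_re _ Complex.I,
        Complex.mul_re _ v]
      simp only [Complex.I_re, Complex.I_im]
      ring
    simp only [Nat.add_sub_cancel]
    have e3 : c * Complex.normSq v * besselBlock c (n + 1 + 1 + 1) (n + 1) w v
        - (n + 1 + 1) * besselBlock c (n + 1 + 1) (n + 1) w v
        + besselBlock c (n + 1) (n + 1) w v = 0 := by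
      unfold besselBlock
      push_cast at hrec
      linear_combination (w * v ^ (n + 1)).re * hrec
    rw [Complex.normSq_apply] at e3
    linear_combination 4 * c * e3 - 4 * c * e2

lemma contDiff_fbSmooth (m : ℕ) (k : FBIndex) : ContDiff ℝ m (fbSmooth k) :=
  contDiff_const.mul (contDiff_besselBlock _ _ _ _ _)

lemma planeLaplacian_const_mul (C : ℝ) {f : ℂ → ℝ} (hf : ContDiff ℝ 2 f) (v : ℂ) :
    planeLaplacian (fun u => C * f u) v = C * planeLaplacian f v := by
  have h1 (u e : ℂ) : fderiv ℝ (fun u => C * f u) u e = C * fderiv ℝ f u e := by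
    rw [fderiv_const_mul ((hf.differentiable (by simp)).differentiableAt)]; rfl
  have hd (e : ℂ) : Differentiable ℝ fun u => fderiv ℝ f u e :=
    ((hf.fderiv_right (m := 1) (by norm_num)).clm_apply contDiff_const).differentiable (by simp)
  unfold planeLaplacian
  simp only [h1]
  rw [fderiv_const_mul (hd _).differentiableAt, fderiv_const_mul (hd _).differentiableAt]
  simp; ring

lemma planeLaplacian_fbSmooth (k : FBIndex) (v : ℂ) :
    planeLaplacian (fbSmooth k) v = -fbEigenvalue k * fbSmooth k v := by
  unfold fbSmooth
  rw [planeLaplacian_const_mul _ (contDiff_besselBlock _ 2 _ _ _), planeLaplacian_besselBlock]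
  unfold fbEigenvalue
  ring

lemma fourier_arg (n : ℕ) (v : ℂ) :
    (‖v‖ : ℂ) ^ n * fourier (n : ℤ) ((v.arg : ℝ) : S1) = v ^ n := by
  rw [fourier_coe_apply]
  have : 2 * (Real.pi : ℂ) * Complex.I * ((n : ℤ) : ℂ) * (v.arg : ℂ) / ((2 * Real.pi : ℝ) : ℂ)
      = n * (v.arg * Complex.I) := by
    have : (Real.pi : ℂ) ≠ 0 := by exact_mod_cast Real.pi_ne_zero
    push_cast; field_simp
  rw [this, Complex.exp_nat_mul, ← mul_pow, Complex.norm_mul_exp_arg_mul_I]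

/-- The factor `r^|n|` of `J_|n|(R r)` and the angular character form `v^|n|`. The polar singularity
disappears, leaving a smooth function cut off at the circle. -/
lemma fbBasis_eq (k : FBIndex) (v : ℂ) :
    fbBasis k v = (Metric.closedBall (0 : ℂ) 1).indicator (fbSmooth k) v := by
  have hraw : fbRaw k v = if ‖v‖ ≤ 1 then besselJ k.1.1.natAbs (k.1.2 * ‖v‖) *
    circleBasis k.1.1 ((v.arg : ℝ) : S1) else 0 := rfl
  rw [fbBasis, hraw]
  by_cases hv : ‖v‖ ≤ 1
  · rw [if_pos hv, Set.indicator_of_mem (by simpa using hv), fbSmooth, besselJ_eq,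
      circleBasis_eq_re, besselBlock, ← fourier_arg, Complex.normSq_eq_norm_sq,
      show (k.1.2 * ‖v‖) ^ 2 / 4 = k.1.2 ^ 2 / 4 * ‖v‖ ^ 2 by ring,
      show ∀ a b : ℂ, a * ((‖v‖ : ℂ) ^ k.1.1.natAbs * b)
        = ((‖v‖ ^ k.1.1.natAbs : ℝ) : ℂ) * (a * b) from fun a b => by push_cast; ring,
      Complex.re_ofReal_mul]
    ring
  · rw [if_neg hv, Set.indicator_of_notMem (by simpa using hv), mul_zero]

lemma fbSmooth_eq_zero (k : FBIndex) {v : ℂ} (hv : ‖v‖ = 1) : fbSmooth k v = 0 := by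
  have h := fbBasis_eq k v
  rw [Set.indicator_of_mem (by simp [hv])] at h
  rw [← h, fbBasis, fbRaw, if_pos hv.le, hv, mul_one, k.2.2]
  simp

/-! ### Green's identity on the unit disk -/

/-- The closed unit disk. -/
abbrev unitDisk : Set ℂ := Metric.closedBall (0 : ℂ) 1

lemma continuous_fderiv_apply {f : ℂ → ℝ} (hf : ContDiff ℝ 1 f) (e : ℂ) :
    Continuous fun v => fderiv ℝ f v e :=
  (hf.continuous_fderiv (by simp)).clm_apply continuous_const

lemma integrableOn_unitDisk {f : ℂ → ℝ} (hf : Continuous f) : IntegrableOn f unitDisk :=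
  hf.continuousOn.integrableOn_compact (isCompact_closedBall _ _)

/-- The divergence theorem by Fubini: every horizontal chord of the disk has its endpoints on the
circle, where `H` vanishes. -/
lemma setIntegral_unitDisk_fderiv_one {H : ℂ → ℝ} (hH : ContDiff ℝ 1 H)
    (h0 : ∀ v : ℂ, ‖v‖ = 1 → H v = 0) : ∫ v in unitDisk, fderiv ℝ H v 1 = 0 := by
  have hc := continuous_fderiv_apply hH 1
  rw [← integral_indicator Metric.isClosed_closedBall.measurableSet]
  have hint : Integrable (unitDisk.indicator fun v => fderiv ℝ H v 1) :=
    (integrable_indicator_iff Metric.isClosed_closedBall.measurableSet).2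
      (integrableOn_unitDisk hc)
  have hmp := Complex.volume_preserving_equiv_real_prod.symm
  rw [← hmp.integral_comp (MeasurableEquiv.measurableEmbedding _)]
  have hint' := (hmp.integrable_comp_emb (MeasurableEquiv.measurableEmbedding _)).2 hint
  rw [Measure.volume_eq_prod] at hint' ⊢
  refine (integral_prod_symm _ hint').trans ?_
  refine integral_eq_zero_of_ae (Eventually.of_forall fun y => ?_)
  simp only [Pi.zero_apply, Function.comp, Complex.measurableEquivRealProd_symm_apply]
  by_cases hy : 1 < y ^ 2
  · have : ∀ x : ℝ, unitDisk.indicator (fun v => fderiv ℝ H v 1) ⟨x, y⟩ = 0 := fun x => by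
      refine Set.indicator_of_notMem (fun hx => ?_) _
      have h1 : ‖(⟨x, y⟩ : ℂ)‖ ≤ 1 := by simpa using hx
      have h2 : ‖(⟨x, y⟩ : ℂ)‖ ^ 2 = x * x + y * y := by
        rw [← Complex.normSq_eq_norm_sq, Complex.normSq_apply]
      nlinarith [norm_nonneg (⟨x, y⟩ : ℂ), sq_nonneg x]
    simp [this]
  · push Not at hy
    set r := √(1 - y ^ 2) with hr
    have hr0 : 0 ≤ r := Real.sqrt_nonneg _
    have hr2 : r ^ 2 = 1 - y ^ 2 := Real.sq_sqrt (by linarith)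
    have hnorm (x : ℝ) : ‖(⟨x, y⟩ : ℂ)‖ ^ 2 = x ^ 2 + y ^ 2 := by
      rw [← Complex.normSq_eq_norm_sq, Complex.normSq_apply]; ring
    have hind : (fun x : ℝ => unitDisk.indicator (fun v => fderiv ℝ H v 1) ⟨x, y⟩)
        = (Set.Icc (-r) r).indicator fun x => fderiv ℝ H ⟨x, y⟩ 1 := by
      ext x
      have : (⟨x, y⟩ : ℂ) ∈ unitDisk ↔ x ∈ Set.Icc (-r) r := by
        rw [mem_closedBall_zero_iff, Set.mem_Icc, ← abs_le, ← sq_le_one_iff₀ (norm_nonneg _),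
          hnorm, ← sq_le_sq₀ (abs_nonneg _) hr0, sq_abs, hr2]
        constructor <;> intro h <;> linarith
      by_cases hx : x ∈ Set.Icc (-r) r
      · rw [Set.indicator_of_mem hx, Set.indicator_of_mem (this.2 hx)]
      · rw [Set.indicator_of_notMem hx, Set.indicator_of_notMem (mt this.1 hx)]
    rw [hind, integral_indicator measurableSet_Icc, integral_Icc_eq_integral_Ioc,
      ← intervalIntegral.integral_of_le (by linarith)]
    have hmk (x : ℝ) : (⟨x, y⟩ : ℂ) = (x : ℂ) + y * Complex.I := Complex.mk_eq_add_mul_I x y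
    have hline (x : ℝ) : HasDerivAt (fun x : ℝ => (⟨x, y⟩ : ℂ)) 1 x := by
      simp only [hmk]
      exact (Complex.ofRealCLM.hasDerivAt (x := x)).add_const _
    have hd (x : ℝ) : HasDerivAt (fun x : ℝ => H ⟨x, y⟩) (fderiv ℝ H ⟨x, y⟩ 1) x :=
      ((hH.differentiable (by simp)).differentiableAt.hasFDerivAt (x := ⟨x, y⟩)).comp_hasDerivAt x
        (hline x)
    have hcl : Continuous fun x : ℝ => (⟨x, y⟩ : ℂ) :=
      continuous_iff_continuousAt.2 fun x => (hline x).continuousAt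
    rw [intervalIntegral.integral_eq_sub_of_hasDerivAt (fun x _ => hd x)
      ((hc.comp hcl).intervalIntegrable _ _)]
    have hend (x : ℝ) (hx : x ^ 2 = r ^ 2) : H ⟨x, y⟩ = 0 := by
      apply h0
      have := hnorm x
      rw [hx, hr2] at this
      rw [← sq_eq_sq₀ (norm_nonneg _) zero_le_one, this]; ring
    rw [hend r rfl, hend (-r) (by ring), sub_zero]

/-- A quarter turn preserves the disk and turns the vertical derivative into the horizontal one. -/
lemma setIntegral_unitDisk_fderiv_I {H : ℂ → ℝ} (hH : ContDiff ℝ 1 H)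
    (h0 : ∀ v : ℂ, ‖v‖ = 1 → H v = 0) : ∫ v in unitDisk, fderiv ℝ H v Complex.I = 0 := by
  let R : ℂ ≃ₗᵢ[ℝ] ℂ := rotation ⟨Complex.I, mem_sphere_zero_iff_norm.2 Complex.norm_I⟩
  have hR (v : ℂ) : R v = Complex.I * v := rotation_apply _ _
  have hK : ContDiff ℝ 1 (H ∘ R) := hH.comp R.toContinuousLinearEquiv.contDiff
  have h := setIntegral_unitDisk_fderiv_one hK fun v hv => h0 (R v) (by rw [R.norm_map, hv])
  have hd (v : ℂ) : fderiv ℝ (H ∘ R) v 1 = fderiv ℝ H (R v) Complex.I := by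
    have := ((hH.differentiable (by simp)).differentiableAt.hasFDerivAt (x := R v)).comp v
      R.toContinuousLinearEquiv.hasFDerivAt
    rw [this.fderiv]
    simp [hR]
  simp only [hd] at h
  have hpre : unitDisk = R ⁻¹' unitDisk := by ext v; simp
  rw [hpre, R.measurePreserving.setIntegral_preimage_emb
    R.toHomeomorph.measurableEmbedding (fun v => fderiv ℝ H v Complex.I)] at h
  exact h

/-- The scalar product of the gradients of two functions on the plane. -/
noncomputable def gradDot (f g : ℂ → ℝ) (v : ℂ) : ℝ :=
  fderiv ℝ f v 1 * fderiv ℝ g v 1 + fderiv ℝ f v Complex.I * fderiv ℝ g v Complex.I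

lemma gradDot_comm (f g : ℂ → ℝ) (v : ℂ) : gradDot f g v = gradDot g f v := by
  unfold gradDot; ring

lemma continuous_gradDot {f g : ℂ → ℝ} (hf : ContDiff ℝ 1 f) (hg : ContDiff ℝ 1 g) :
    Continuous (gradDot f g) :=
  ((continuous_fderiv_apply hf 1).mul (continuous_fderiv_apply hg 1)).add
    ((continuous_fderiv_apply hf _).mul (continuous_fderiv_apply hg _))

lemma norm_fderiv_le_sqrt_gradDot (f : ℂ → ℝ) (v : ℂ) :
    ‖fderiv ℝ f v‖ ≤ √(gradDot f f v) := by
  refine ContinuousLinearMap.opNorm_le_bound _ (Real.sqrt_nonneg _) fun e => ?_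
  have he : fderiv ℝ f v e = e.re * fderiv ℝ f v 1 + e.im * fderiv ℝ f v Complex.I := by
    conv_lhs => rw [← Complex.re_add_im e, map_add]
    rw [show (e.re : ℂ) = e.re • (1 : ℂ) by simp,
      show (e.im : ℂ) * Complex.I = e.im • Complex.I by simp, map_smul, map_smul]
    rfl
  have hnn : 0 ≤ gradDot f f v := add_nonneg (mul_self_nonneg _) (mul_self_nonneg _)
  rw [Complex.norm_eq_sqrt_sq_add_sq e, ← Real.sqrt_mul hnn, Real.norm_eq_abs]
  apply Real.abs_le_sqrt
  rw [he]; unfold gradDot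
  nlinarith [sq_nonneg (e.re * fderiv ℝ f v Complex.I - e.im * fderiv ℝ f v 1)]

/-- The divergence of `f ∇g` has integral zero because `f` vanishes on the circle. -/
lemma setIntegral_gradDot {f g : ℂ → ℝ} (hf : ContDiff ℝ 1 f) (hg : ContDiff ℝ 2 g)
    (h0 : ∀ v : ℂ, ‖v‖ = 1 → f v = 0) :
    ∫ v in unitDisk, gradDot f g v = -∫ v in unitDisk, f v * planeLaplacian g v := by
  have hg' (e : ℂ) : ContDiff ℝ 1 fun v => fderiv ℝ g v e :=
    (hg.fderiv_right (m := 1) (by norm_num)).clm_apply contDiff_const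
  have hH (e : ℂ) : ContDiff ℝ 1 fun v => f v * fderiv ℝ g v e := hf.mul (hg' e)
  have hD (e v : ℂ) : fderiv ℝ (fun v => f v * fderiv ℝ g v e) v e
      = fderiv ℝ f v e * fderiv ℝ g v e + f v * fderiv ℝ (fun u => fderiv ℝ g u e) v e := by
    have h := fderiv_fun_mul ((hf.differentiable (by simp)).differentiableAt (x := v))
      (((hg' e).differentiable (by simp)).differentiableAt (x := v))
    rw [h]
    simp only [add_apply, smul_apply, smul_eq_mul]
    ring
  have h1 := setIntegral_unitDisk_fderiv_one (hH 1) fun v hv => by simp [h0 v hv]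
  have h2 := setIntegral_unitDisk_fderiv_I (hH Complex.I) fun v hv => by simp [h0 v hv]
  have hc (e : ℂ) := integrableOn_unitDisk (continuous_fderiv_apply (hH e) e)
  have h3 := integral_add (hc 1) (hc Complex.I)
  rw [h1, h2, add_zero] at h3
  have hLc : Continuous fun v => f v * planeLaplacian g v :=
    hf.continuous.mul ((continuous_fderiv_apply (hg' 1) 1).add
      (continuous_fderiv_apply (hg' Complex.I) Complex.I))
  rw [eq_neg_iff_add_eq_zero, ← integral_add
    (integrableOn_unitDisk (continuous_gradDot hf (hg.of_le (by norm_num))))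
    (integrableOn_unitDisk hLc), ← h3]
  congr 1; ext v
  simp only [hD, gradDot, planeLaplacian]
  ring

/-- Poincaré's inequality on the unit disk. -/
lemma setIntegral_sq_le_gradDot {f : ℂ → ℝ} (hf : ContDiff ℝ 1 f)
    (h0 : ∀ v : ℂ, ‖v‖ = 1 → f v = 0) :
    ∫ v in unitDisk, f v ^ 2 ≤ ∫ v in unitDisk, gradDot f f v := by
  -- The field `f² v` has divergence `2f² + 2f v·∇f`, of integral zero. On the disk this is at least
  -- `f² - |∇f|²`, because `(f + v·∇f)² ≥ 0` and `|v·∇f| ≤ |∇f|`.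
  have hre : ContDiff ℝ 1 fun v : ℂ => v.re := Complex.reCLM.contDiff
  have him : ContDiff ℝ 1 fun v : ℂ => v.im := Complex.imCLM.contDiff
  have hf2 : ContDiff ℝ 1 fun v => f v * f v := hf.mul hf
  have hfd (v : ℂ) := (hf.differentiable (by simp)).differentiableAt.hasFDerivAt (x := v)
  have d1 (v : ℂ) : fderiv ℝ (fun v : ℂ => v.re * (f v * f v)) v 1
      = f v ^ 2 + 2 * v.re * f v * fderiv ℝ f v 1 := by
    have h : HasFDerivAt (fun v : ℂ => v.re * (f v * f v)) _ v :=
      (Complex.reCLM.hasFDerivAt (x := v)).mul ((hfd v).mul (hfd v))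
    rw [h.fderiv]
    simp only [add_apply, smul_apply, smul_eq_mul, Complex.reCLM_apply, Complex.one_re]
    ring
  have d2 (v : ℂ) : fderiv ℝ (fun v : ℂ => v.im * (f v * f v)) v Complex.I
      = f v ^ 2 + 2 * v.im * f v * fderiv ℝ f v Complex.I := by
    have h : HasFDerivAt (fun v : ℂ => v.im * (f v * f v)) _ v :=
      (Complex.imCLM.hasFDerivAt (x := v)).mul ((hfd v).mul (hfd v))
    rw [h.fderiv]
    simp only [add_apply, smul_apply, smul_eq_mul, Complex.imCLM_apply, Complex.I_im]
    ring
  have h1 := setIntegral_unitDisk_fderiv_one (hre.mul hf2) fun v hv => by simp [h0 v hv]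
  have h2 := setIntegral_unitDisk_fderiv_I (him.mul hf2) fun v hv => by simp [h0 v hv]
  have h3 := integral_add
    (integrableOn_unitDisk (continuous_fderiv_apply (hre.mul hf2) 1))
    (integrableOn_unitDisk (continuous_fderiv_apply (him.mul hf2) Complex.I))
  rw [h1, h2, add_zero] at h3
  have hcont : Continuous fun v => f v ^ 2 := hf.continuous.pow 2
  have hG := continuous_gradDot hf hf
  rw [← sub_nonpos, ← integral_sub (integrableOn_unitDisk hcont) (integrableOn_unitDisk hG),
    ← h3]
  refine setIntegral_mono_on (integrableOn_unitDisk (hcont.sub hG))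
    (integrableOn_unitDisk ((continuous_fderiv_apply (hre.mul hf2) 1).add
      (continuous_fderiv_apply (him.mul hf2) Complex.I))) Metric.isClosed_closedBall.measurableSet
    fun v hv => ?_
  have hv1 : v.re ^ 2 + v.im ^ 2 ≤ 1 := by
    have h : ‖v‖ ≤ 1 := by simpa using hv
    have h2 := Complex.normSq_eq_norm_sq v
    rw [Complex.normSq_apply] at h2
    nlinarith [norm_nonneg v]
  rw [d1, d2]
  unfold gradDot
  nlinarith [sq_nonneg (f v + v.re * fderiv ℝ f v 1 + v.im * fderiv ℝ f v Complex.I),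
    sq_nonneg (v.re * fderiv ℝ f v Complex.I - v.im * fderiv ℝ f v 1),
    mul_nonneg (sub_nonneg.2 hv1) (add_nonneg (sq_nonneg (fderiv ℝ f v 1))
      (sq_nonneg (fderiv ℝ f v Complex.I)))]

/-! ### Orthogonality of the Fourier-Bessel functions -/

lemma setIntegral_gradDot_fbSmooth (k k' : FBIndex) :
    ∫ v in unitDisk, gradDot (fbSmooth k) (fbSmooth k') v
      = fbEigenvalue k' * ∫ v in unitDisk, fbSmooth k v * fbSmooth k' v := by
  rw [setIntegral_gradDot (contDiff_fbSmooth 1 k) (contDiff_fbSmooth 2 k')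
    fun v hv => fbSmooth_eq_zero k hv, ← integral_neg, ← integral_const_mul]
  congr 1; ext v
  rw [planeLaplacian_fbSmooth]; ring

lemma setIntegral_fbSmooth_mul (k k' : FBIndex) :
    ∫ v in unitDisk, fbSmooth k v * fbSmooth k' v = ∫ v, fbBasis k v * fbBasis k' v := by
  rw [← integral_indicator Metric.isClosed_closedBall.measurableSet]
  congr 1; ext v
  rw [fbBasis_eq, fbBasis_eq]
  by_cases hv : v ∈ unitDisk
  · simp only [Set.indicator_of_mem hv]
  · simp only [Set.indicator_of_notMem hv, mul_zero]

lemma integral_circleBasis_mul_Ioo (n n' : ℤ) (h : n ≠ n') :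
    ∫ θ in Set.Ioo (-Real.pi) Real.pi,
      circleBasis n ((θ : ℝ) : S1) * circleBasis n' ((θ : ℝ) : S1) = 0 := by
  have h1 := AddCircle.integral_preimage (2 * Real.pi) (-Real.pi)
    fun β : S1 => circleBasis n β * circleBasis n' β
  rw [AddCircle.volume_eq_smul_haarAddCircle, integral_smul_measure, integral_circleBasis_mul,
    if_neg h, smul_zero, show -Real.pi + 2 * Real.pi = Real.pi by ring,
    integral_Ioc_eq_integral_Ioo] at h1
  exact h1

lemma integral_fbBasis_mul_of_angular_ne (k k' : FBIndex) (h : k.1.1 ≠ k'.1.1) :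
    ∫ v, fbBasis k v * fbBasis k' v = 0 := by
  have h1 : ∫ v, fbRaw k v * fbRaw k' v = 0 := by
    rw [← Complex.integral_comp_polarCoord_symm]
    have h2 := setIntegral_prod_mul (μ := (volume : Measure ℝ)) (ν := (volume : Measure ℝ))
      (fun r : ℝ => if r ≤ 1 then r * (besselJ k.1.1.natAbs (k.1.2 * r) *
        besselJ k'.1.1.natAbs (k'.1.2 * r)) else 0)
      (fun θ : ℝ => circleBasis k.1.1 (θ : S1) * circleBasis k'.1.1 (θ : S1))
      (Set.Ioi 0) (Set.Ioo (-Real.pi) Real.pi)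
    rw [integral_circleBasis_mul_Ioo _ _ h, mul_zero, ← Measure.volume_eq_prod] at h2
    rw [← h2]
    refine setIntegral_congr_fun (by measurability) fun p hp => ?_
    obtain ⟨hp1, hp2⟩ := hp
    have hp1 : 0 < p.1 := hp1
    have harg : (Complex.polarCoord.symm p).arg = p.2 := by
      rw [Complex.polarCoord_symm_apply]; push_cast
      exact Complex.arg_mul_cos_add_sin_mul_I hp1 ⟨hp2.1, hp2.2.le⟩
    have hn : ‖Complex.polarCoord.symm p‖ = p.1 := by
      rw [Complex.norm_polarCoord_symm, abs_of_pos hp1]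
    simp only [fbRaw, harg, hn, smul_eq_mul]
    split_ifs <;> ring
  unfold fbBasis
  rw [show (fun v => √(Real.pi / ∫ w : ℂ, fbRaw k w ^ 2) * fbRaw k v *
    (√(Real.pi / ∫ w : ℂ, fbRaw k' w ^ 2) * fbRaw k' v)) = fun v =>
    (√(Real.pi / ∫ w : ℂ, fbRaw k w ^ 2) * √(Real.pi / ∫ w : ℂ, fbRaw k' w ^ 2)) *
    (fbRaw k v * fbRaw k' v) from funext fun v => by ring, integral_const_mul, h1, mul_zero]

/-- For equal angular indices the radii differ, hence so do the eigenvalues, and the symmetry of the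
Dirichlet form forces orthogonality. For different angular indices the angular integral already
vanishes. -/
lemma setIntegral_fbSmooth_mul_of_ne {k k' : FBIndex} (h : k ≠ k') :
    ∫ v in unitDisk, fbSmooth k v * fbSmooth k' v = 0 := by
  by_cases hn : k.1.1 = k'.1.1
  · have hR : k.1.2 ≠ k'.1.2 := fun hR => h (Subtype.ext (Prod.ext hn hR))
    have hμ : fbEigenvalue k - fbEigenvalue k' ≠ 0 := by
      unfold fbEigenvalue
      rw [sub_ne_zero]
      exact fun he => hR ((sq_eq_sq₀ k.2.1.le k'.2.1.le).1 he)
    have h1 := setIntegral_gradDot_fbSmooth k k'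
    have h2 := setIntegral_gradDot_fbSmooth k' k
    simp only [gradDot_comm (fbSmooth k') (fbSmooth k), mul_comm (fbSmooth k' _)] at h2
    rw [h1] at h2
    refine (mul_eq_zero.1 ?_).resolve_left hμ
    linarith
  · rw [setIntegral_fbSmooth_mul, integral_fbBasis_mul_of_angular_ne _ _ hn]

/-- The upper bound suffices and spares a proof that the function is not null: if its square had
integral zero, division by zero would make the normalising factor `0`. -/
lemma setIntegral_fbSmooth_sq_le (k : FBIndex) :
    ∫ v in unitDisk, fbSmooth k v * fbSmooth k v ≤ Real.pi := by
  rw [setIntegral_fbSmooth_mul]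
  set I := ∫ w : ℂ, fbRaw k w ^ 2 with hI
  have hI0 : 0 ≤ I := integral_nonneg fun w => sq_nonneg _
  have : ∫ v, fbBasis k v * fbBasis k v = Real.pi / I * I := by
    rw [hI, ← integral_const_mul]
    congr 1; ext v
    rw [fbBasis, ← hI]
    have := Real.mul_self_sqrt (div_nonneg Real.pi_pos.le hI0)
    linear_combination fbRaw k v ^ 2 * this
  rw [this]
  rcases hI0.eq_or_lt with h | h
  · rw [← h]; simp [Real.pi_pos.le]
  · rw [div_mul_cancel₀ _ h.ne']

/-! ### Finite Fourier-Bessel expansions -/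

/-- The smooth function `∑_{(k,m)∈s} a(k,m) Ψ_k(v) φ_m(β)`. -/
noncomputable def fbSum (s : Finset (FBIndex × ℤ)) (a : FBIndex × ℤ → ℝ) (β : S1) (v : ℂ) : ℝ :=
  ∑ q ∈ s, a q * circleBasis q.2 β * fbSmooth q.1 v

/-- `∑_{(k,m)∈s} μ_k a(k,m)²`. -/
noncomputable def fbEnergy (s : Finset (FBIndex × ℤ)) (a : FBIndex × ℤ → ℝ) : ℝ :=
  ∑ q ∈ s, fbEigenvalue q.1 * a q ^ 2

lemma contDiff_fbSum (m : ℕ) (s : Finset (FBIndex × ℤ)) (a : FBIndex × ℤ → ℝ) (β : S1) :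
    ContDiff ℝ m (fbSum s a β) :=
  ContDiff.sum fun q _ => contDiff_const.mul (contDiff_fbSmooth m q.1)

lemma fbSum_eq_zero (s : Finset (FBIndex × ℤ)) (a : FBIndex × ℤ → ℝ) (β : S1) {v : ℂ}
    (hv : ‖v‖ = 1) : fbSum s a β v = 0 :=
  Finset.sum_eq_zero fun q _ => by rw [fbSmooth_eq_zero q.1 hv, mul_zero]

lemma gradDot_fbSum (s : Finset (FBIndex × ℤ)) (a : FBIndex × ℤ → ℝ) (β : S1) (v : ℂ) :
    gradDot (fbSum s a β) (fbSum s a β) v = ∑ q ∈ s, ∑ q' ∈ s,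
      a q * a q' * (circleBasis q.2 β * circleBasis q'.2 β) *
        gradDot (fbSmooth q.1) (fbSmooth q'.1) v := by
  have hd (e : ℂ) : fderiv ℝ (fbSum s a β) v e
      = ∑ q ∈ s, a q * circleBasis q.2 β * fderiv ℝ (fbSmooth q.1) v e := by
    have h : HasFDerivAt (fbSum s a β)
        (∑ q ∈ s, (a q * circleBasis q.2 β) • fderiv ℝ (fbSmooth q.1) v) v :=
      HasFDerivAt.fun_sum fun q _ =>
        (((contDiff_fbSmooth 1 q.1).differentiable (by simp)).differentiableAt.hasFDerivAt).const_mul _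
    rw [h.fderiv]; simp
  unfold gradDot
  rw [hd, hd, Finset.sum_mul_sum, Finset.sum_mul_sum, ← Finset.sum_add_distrib]
  refine Finset.sum_congr rfl fun q _ => ?_
  rw [← Finset.sum_add_distrib]
  refine Finset.sum_congr rfl fun q' _ => ?_
  ring

lemma continuous_gradDot_fbSum (s : Finset (FBIndex × ℤ)) (a : FBIndex × ℤ → ℝ) :
    Continuous fun p : S1 × ℂ => gradDot (fbSum s a p.1) (fbSum s a p.1) p.2 := by
  simp only [gradDot_fbSum]
  refine continuous_finsetSum _ fun q _ => continuous_finsetSum _ fun q' _ => ?_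
  exact (continuous_const.mul (((continuous_circleBasis _).comp continuous_fst).mul
    ((continuous_circleBasis _).comp continuous_fst))).mul
    ((continuous_gradDot (contDiff_fbSmooth 1 _) (contDiff_fbSmooth 1 _)).comp continuous_snd)

lemma continuous_fbSum (s : Finset (FBIndex × ℤ)) (a : FBIndex × ℤ → ℝ) :
    Continuous fun p : S1 × ℂ => fbSum s a p.1 p.2 :=
  continuous_finsetSum _ fun q _ => (continuous_const.mul
    ((continuous_circleBasis _).comp continuous_fst)).mul
    ((contDiff_fbSmooth 0 q.1).continuous.comp continuous_snd)

lemma integrable_circle {f : S1 → ℝ} (hf : Continuous f) : Integrable f circleMeasure :=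
  hf.integrable_of_hasCompactSupport (HasCompactSupport.of_compactSpace _)

/-- The products `ψ_k φ_m` are orthogonal for the Dirichlet form integrated over the circle. Only
diagonal terms survive, each at most `π μ_k a(k,m)²`. -/
lemma integral_gradDot_fbSum_le (s : Finset (FBIndex × ℤ)) (a : FBIndex × ℤ → ℝ) :
    ∫ β : S1, (∫ v in unitDisk, gradDot (fbSum s a β) (fbSum s a β) v) ∂circleMeasure
      ≤ Real.pi * fbEnergy s a := by
  classical
  have h1 (β : S1) : ∫ v in unitDisk, gradDot (fbSum s a β) (fbSum s a β) v
      = ∑ q ∈ s, ∑ q' ∈ s, a q * a q' * (circleBasis q.2 β * circleBasis q'.2 β) *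
        ∫ v in unitDisk, gradDot (fbSmooth q.1) (fbSmooth q'.1) v := by
    simp only [gradDot_fbSum]
    have hi (q q' : FBIndex × ℤ) : IntegrableOn (fun v => a q * a q' *
        (circleBasis q.2 β * circleBasis q'.2 β) * gradDot (fbSmooth q.1) (fbSmooth q'.1) v)
        unitDisk := integrableOn_unitDisk (continuous_const.mul
          (continuous_gradDot (contDiff_fbSmooth 1 _) (contDiff_fbSmooth 1 _)))
    rw [integral_finsetSum _ fun q _ => integrable_finsetSum _ fun q' _ => hi q q']
    refine Finset.sum_congr rfl fun q _ => ?_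
    rw [integral_finsetSum _ fun q' _ => hi q q']
    refine Finset.sum_congr rfl fun q' _ => ?_
    rw [integral_const_mul]
  simp only [h1]
  have hi (q q' : FBIndex × ℤ) : Integrable (fun β => a q * a q' *
      (circleBasis q.2 β * circleBasis q'.2 β) *
        ∫ v in unitDisk, gradDot (fbSmooth q.1) (fbSmooth q'.1) v) circleMeasure :=
    integrable_circle ((continuous_const.mul ((continuous_circleBasis _).mul
      (continuous_circleBasis _))).mul continuous_const)
  rw [integral_finsetSum _ fun q _ => integrable_finsetSum _ fun q' _ => hi q q', fbEnergy,
    Finset.mul_sum]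
  refine Finset.sum_le_sum fun q hq => ?_
  rw [integral_finsetSum _ fun q' _ => hi q q', Finset.sum_eq_single_of_mem q hq]
  · rw [integral_mul_const, integral_const_mul, integral_circleBasis_mul, if_pos rfl,
      setIntegral_gradDot_fbSmooth]
    have h2 := setIntegral_fbSmooth_sq_le q.1
    have h3 : 0 ≤ fbEigenvalue q.1 := sq_nonneg _
    have h4 : 0 ≤ fbEigenvalue q.1 * a q ^ 2 := mul_nonneg h3 (sq_nonneg _)
    nlinarith [mul_le_mul_of_nonneg_left h2 h4]
  · intro q' _ hne
    rw [integral_mul_const, integral_const_mul, integral_circleBasis_mul]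
    by_cases h2 : q.2 = q'.2
    · have : q.1 ≠ q'.1 := fun h => hne (Prod.ext h.symm h2.symm)
      rw [setIntegral_gradDot_fbSmooth, setIntegral_fbSmooth_mul_of_ne this]; simp
    · rw [if_neg h2]; simp

/-- Poincaré's inequality at each fixed angle takes the place of the bound `μ_k ≥ 1` on the zeros of
Bessel functions. -/
lemma integral_sq_fbSum_le (s : Finset (FBIndex × ℤ)) (a : FBIndex × ℤ → ℝ) :
    ∫ β : S1, (∫ v in unitDisk, fbSum s a β v ^ 2) ∂circleMeasure ≤ Real.pi * fbEnergy s a := by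
  refine le_trans (integral_mono_of_nonneg
    (Eventually.of_forall fun β => integral_nonneg fun v => sq_nonneg _) ?_
    (Eventually.of_forall fun β => setIntegral_sq_le_gradDot (contDiff_fbSum 1 s a β)
      fun v hv => fbSum_eq_zero s a β hv)) (integral_gradDot_fbSum_le s a)
  refine integrable_circle ?_
  exact continuous_parametric_integral_of_continuous (μ := volume) (s := unitDisk)
    (f := fun β v => gradDot (fbSum s a β) (fbSum s a β) v)
    (continuous_gradDot_fbSum s a) (isCompact_closedBall _ _)

/-- Cauchy-Schwarz on the circle times the unit disk, a set of measure `π`. -/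
lemma lintegral_enorm_le_of_integral_sq_le {f : S1 → ℂ → ℝ}
    (hf : Continuous fun p : S1 × ℂ => f p.1 p.2) {T : ℝ}
    (h : ∫ β : S1, (∫ v in unitDisk, f β v ^ 2) ∂circleMeasure ≤ Real.pi * T) :
    ∫⁻ β : S1, (∫⁻ v in unitDisk, ‖f β v‖ₑ) ∂circleMeasure ≤ ENNReal.ofReal (Real.pi * √T) := by
  set ν : Measure (S1 × ℂ) := (circleMeasure).prod (volume.restrict unitDisk) with hν
  have hfm : Measurable fun p : S1 × ℂ => f p.1 p.2 := hf.measurable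
  have huniv : ν Set.univ = ENNReal.ofReal Real.pi := by
    rw [hν, ← Set.univ_prod_univ, Measure.prod_prod]
    simp only [measure_univ, Measure.restrict_apply_univ, Complex.volume_closedBall, one_mul,
      ENNReal.ofReal_one, one_pow]
    rw [← NNReal.coe_real_pi, ENNReal.ofReal_coe_nnreal]
  have hint : Integrable (fun p : S1 × ℂ => f p.1 p.2 ^ 2) ν := by
    have : ν = ((circleMeasure).prod (volume : Measure ℂ)).restrict (Set.univ ×ˢ unitDisk) := by
      rw [hν, ← Measure.prod_restrict, Measure.restrict_univ]
    rw [this]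
    exact (hf.pow 2).continuousOn.integrableOn_compact
      (isCompact_univ.prod (isCompact_closedBall _ _))
  have hT : 0 ≤ T := by
    have : 0 ≤ Real.pi * T := le_trans
      (integral_nonneg fun β => integral_nonneg fun v => sq_nonneg _) h
    exact nonneg_of_mul_nonneg_right this Real.pi_pos
  have h2 : eLpNorm (fun p : S1 × ℂ => f p.1 p.2) 2 ν ≤ ENNReal.ofReal (√(Real.pi * T)) := by
    have hsq : eLpNorm (fun p : S1 × ℂ => f p.1 p.2) 2 ν ^ 2
        = ENNReal.ofReal (∫ p, f p.1 p.2 ^ 2 ∂ν) := by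
      rw [ofReal_integral_eq_lintegral_ofReal hint (Eventually.of_forall fun p => sq_nonneg _)]
      rw [← ENNReal.rpow_natCast, show ((2 : ℕ) : ℝ) = ((2 : NNReal) : ℝ) by simp]
      erw [eLpNorm_nnreal_pow_eq_lintegral (by simp)]
      refine lintegral_congr fun p => ?_
      rw [← sq_abs, ENNReal.ofReal_pow (abs_nonneg _), ← Real.norm_eq_abs, ofReal_norm]
      simp
    rw [← ENNReal.pow_le_pow_left_iff two_ne_zero, hsq, ← ENNReal.ofReal_pow (Real.sqrt_nonneg _),
      Real.sq_sqrt (mul_nonneg Real.pi_pos.le hT), hν, integral_prod _ hint]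
    exact ENNReal.ofReal_le_ofReal h
  rw [← lintegral_prod (μ := circleMeasure) (ν := volume.restrict unitDisk)
    (fun p : S1 × ℂ => ‖f p.1 p.2‖ₑ) hfm.enorm.aemeasurable, ← hν, ← eLpNorm_one_eq_lintegral_enorm]
  refine (eLpNorm_le_eLpNorm_mul_rpow_measure_univ (p := 1) (q := 2) (by norm_num)
    hfm.aestronglyMeasurable).trans ?_
  rw [huniv]
  refine (mul_le_mul_left h2 _).trans (le_of_eq ?_)
  rw [ENNReal.ofReal_rpow_of_pos Real.pi_pos, ← ENNReal.ofReal_mul (Real.sqrt_nonneg _)]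
  congr 1
  rw [Real.sqrt_mul Real.pi_pos.le, show (1 / (1 : ℝ≥0∞).toReal - 1 / (2 : ℝ≥0∞).toReal) = 1 / 2 by
    norm_num, ← Real.sqrt_eq_rpow]
  linear_combination √T * Real.mul_self_sqrt Real.pi_pos.le

lemma lintegral_enorm_fbSum_le (s : Finset (FBIndex × ℤ)) (a : FBIndex × ℤ → ℝ) :
    ∫⁻ β : S1, (∫⁻ v in unitDisk, ‖fbSum s a β v‖ₑ) ∂circleMeasure
      ≤ ENNReal.ofReal (Real.pi * √(fbEnergy s a)) :=
  lintegral_enorm_le_of_integral_sq_le (continuous_fbSum s a) (integral_sq_fbSum_le s a)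

lemma lintegral_enorm_fderiv_fbSum_le (s : Finset (FBIndex × ℤ)) (a : FBIndex × ℤ → ℝ) :
    ∫⁻ β : S1, (∫⁻ v in unitDisk, ‖fderiv ℝ (fbSum s a β) v‖ₑ) ∂circleMeasure
      ≤ ENNReal.ofReal (Real.pi * √(fbEnergy s a)) := by
  refine le_trans (lintegral_mono fun β => lintegral_mono fun v => ?_)
    (lintegral_enorm_le_of_integral_sq_le
      (f := fun β v => √(gradDot (fbSum s a β) (fbSum s a β) v))
      (continuous_gradDot_fbSum s a).sqrt ?_)
  · rw [enorm_le_iff_norm_le, Real.norm_of_nonneg (Real.sqrt_nonneg _)]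
    exact norm_fderiv_le_sqrt_gradDot _ _
  · simp only [Real.sq_sqrt (add_nonneg (mul_self_nonneg _) (mul_self_nonneg _)), gradDot]
    exact integral_gradDot_fbSum_le s a

/-! ### Small deformations of the plane -/

lemma det_eq (A : ℂ →L[ℝ] ℂ) :
    A.det = (A 1).re * (A Complex.I).im - (A Complex.I).re * (A 1).im := by
  rw [ContinuousLinearMap.det, ← LinearMap.det_toMatrix Complex.basisOneI, Matrix.det_fin_two]
  simp [LinearMap.toMatrix_apply]

/-- `det (1 - A) = 1 - tr A + det A`, with `|tr A| ≤ 2ε` and `|det A| ≤ ε²`. -/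
lemma abs_det_id_sub_sub_one_le {A : ℂ →L[ℝ] ℂ} {ε : ℝ} (hA : ‖A‖ ≤ ε) :
    |(ContinuousLinearMap.id ℝ ℂ - A).det - 1| ≤ 2 * ε + ε ^ 2 := by
  have hε : 0 ≤ ε := (norm_nonneg A).trans hA
  have h1 : ‖A 1‖ ≤ ε := by simpa using (A.le_opNorm 1).trans (by simpa using hA)
  have h2 : ‖A Complex.I‖ ≤ ε := by
    simpa using (A.le_opNorm Complex.I).trans (by simpa using hA)
  have h3 := Complex.normSq_eq_norm_sq (A 1)
  have h4 := Complex.normSq_eq_norm_sq (A Complex.I)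
  rw [Complex.normSq_apply] at h3 h4
  have h5 := (Complex.abs_re_le_norm (A 1)).trans h1
  have h6 := (Complex.abs_im_le_norm (A Complex.I)).trans h2
  have h7 : ‖A 1‖ ^ 2 ≤ ε ^ 2 := pow_le_pow_left₀ (norm_nonneg _) h1 2
  have h8 : ‖A Complex.I‖ ^ 2 ≤ ε ^ 2 := pow_le_pow_left₀ (norm_nonneg _) h2 2
  rw [det_eq]
  simp only [sub_apply, ContinuousLinearMap.id_apply, Complex.sub_re, Complex.sub_im,
    Complex.one_re, Complex.one_im, Complex.I_re, Complex.I_im]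
  rw [abs_le] at *
  constructor <;> nlinarith [sq_nonneg ((A 1).re + (A Complex.I).im),
    sq_nonneg ((A 1).re - (A Complex.I).im), sq_nonneg ((A 1).im + (A Complex.I).re),
    sq_nonneg ((A 1).im - (A Complex.I).re)]

/-- A `C¹` displacement field with gradient bounded by `ε < 1/5`. -/
structure SmallField (τ : ℂ → ℂ) (ε : ℝ) : Prop where
  contDiff : ContDiff ℝ 1 τ
  bound : ∀ u, ‖fderiv ℝ τ u‖ ≤ ε
  lt : ε < 1 / 5

namespace SmallField

variable {τ : ℂ → ℂ} {ε : ℝ}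

lemma nonneg (h : SmallField τ ε) : 0 ≤ ε := (norm_nonneg _).trans (h.bound 0)

lemma smul (h : SmallField τ ε) {s : ℝ} (hs0 : 0 ≤ s) (hs1 : s ≤ 1) :
    SmallField (fun u => (s : ℂ) * τ u) ε where
  contDiff := contDiff_const.mul h.contDiff
  bound u := by
    rw [fderiv_const_mul (h.contDiff.differentiable (by simp)).differentiableAt, norm_smul]
    have := h.bound u
    have h2 := norm_nonneg (fderiv ℝ τ u)
    rw [Complex.norm_real, Real.norm_of_nonneg hs0]
    nlinarith
  lt := h.lt

lemma norm_sub_le (h : SmallField τ ε) (z u : ℂ) : ‖τ z - τ u‖ ≤ ε * ‖z - u‖ :=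
  Convex.norm_image_sub_le_of_norm_fderiv_le (𝕜 := ℝ) (s := Set.univ)
    (fun _ _ => (h.contDiff.differentiable (by simp)).differentiableAt)
    (fun u _ => h.bound u) convex_univ (Set.mem_univ u) (Set.mem_univ z)

/-- The deformation `u ↦ u - τ(u)`. -/
lemma hasFDerivAt (h : SmallField τ ε) (u : ℂ) :
    HasFDerivAt (fun u => u - τ u) (ContinuousLinearMap.id ℝ ℂ - fderiv ℝ τ u) u :=
  (hasFDerivAt_id u).sub (h.contDiff.differentiable (by simp)).differentiableAt.hasFDerivAt

/-- Here `2ε + ε² ≤ (2 + 1/5) ε`. Inserting `ε < 1/5` once more gives the Jacobian bounds `1 ∓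
11/25`, that is `14/25` and `36/25`. -/
lemma abs_abs_det_sub_one_le (h : SmallField τ ε) (u : ℂ) :
    |(|(ContinuousLinearMap.id ℝ ℂ - fderiv ℝ τ u).det| - 1)| ≤ 11 / 5 * ε := by
  have h1 := abs_det_id_sub_sub_one_le (h.bound u)
  have h2 : 2 * ε + ε ^ 2 ≤ 11 / 5 * ε := by nlinarith [h.nonneg, h.lt]
  have h3 := abs_abs_sub_abs_le (ContinuousLinearMap.id ℝ ℂ - fderiv ℝ τ u).det 1
  rw [abs_one] at h3
  exact h3.trans (h1.trans h2)

lemma le_abs_det (h : SmallField τ ε) (u : ℂ) :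
    14 / 25 ≤ |(ContinuousLinearMap.id ℝ ℂ - fderiv ℝ τ u).det| := by
  have := (abs_le.1 (h.abs_abs_det_sub_one_le u)).1
  linarith [h.lt]

lemma abs_det_le (h : SmallField τ ε) (u : ℂ) :
    |(ContinuousLinearMap.id ℝ ℂ - fderiv ℝ τ u).det| ≤ 36 / 25 := by
  have := (abs_le.1 (h.abs_abs_det_sub_one_le u)).2
  linarith [h.lt]

lemma norm_deform_sub_ge (h : SmallField τ ε) (z u : ℂ) :
    4 / 5 * ‖z - u‖ ≤ ‖(z - τ z) - (u - τ u)‖ := by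
  have h1 := h.norm_sub_le z u
  have h2 := norm_sub_norm_le (z - u) (τ z - τ u)
  rw [show (z - u) - (τ z - τ u) = (z - τ z) - (u - τ u) by ring] at h2
  nlinarith [norm_nonneg (z - u), h.lt]

lemma injective (h : SmallField τ ε) : Function.Injective fun u => u - τ u := by
  intro z u hzu
  have h1 := h.norm_deform_sub_ge z u
  rw [sub_eq_zero.2 hzu, norm_zero] at h1
  exact sub_eq_zero.1 (norm_le_zero_iff.1 (by linarith))

/-- A preimage of `y` is a fixed point of the contraction `z ↦ y + τ z`. Surjectivity makes the
change of variables exact over the whole plane. -/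
lemma surjective (h : SmallField τ ε) : Function.Surjective fun u => u - τ u := by
  intro y
  have hc : ContractingWith ⟨ε, h.nonneg⟩ fun z => y + τ z := by
    refine ⟨?_, LipschitzWith.of_dist_le_mul fun z u => ?_⟩
    · have := h.lt
      exact_mod_cast (show ε < 1 by linarith)
    · rw [dist_eq_norm, dist_eq_norm, add_sub_add_left_eq_sub]
      exact h.norm_sub_le z u
  refine ⟨hc.fixedPoint, ?_⟩
  have := hc.fixedPoint_isFixedPt
  rw [Function.IsFixedPt] at this
  exact sub_eq_of_eq_add this.symm

lemma continuous (h : SmallField τ ε) : Continuous fun u => u - τ u :=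
  continuous_id.sub h.contDiff.continuous

lemma measurableEmbedding (h : SmallField τ ε) : MeasurableEmbedding fun u => u - τ u :=
  h.continuous.measurableEmbedding h.injective

/-- The Jacobian of the deformation. -/
lemma lintegral_comp_mul_det (h : SmallField τ ε) (G : ℂ → ℝ≥0∞) :
    ∫⁻ u, ENNReal.ofReal |(ContinuousLinearMap.id ℝ ℂ - fderiv ℝ τ u).det| * G (u - τ u)
      = ∫⁻ u, G u := by
  have := lintegral_image_eq_lintegral_abs_det_fderiv_mul volume MeasurableSet.univ
    (fun u _ => (h.hasFDerivAt u).hasFDerivWithinAt) h.injective.injOn G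
  rw [Set.image_univ, h.surjective.range_eq] at this
  simpa using this.symm

lemma lintegral_comp_le (h : SmallField τ ε) (G : ℂ → ℝ≥0∞) :
    ∫⁻ u, G (u - τ u) ≤ ENNReal.ofReal (25 / 14) * ∫⁻ u, G u := by
  rw [← h.lintegral_comp_mul_det G, ← lintegral_const_mul' _ _ ENNReal.ofReal_ne_top]
  refine lintegral_mono fun u => ?_
  simp only
  rw [← mul_assoc, ← ENNReal.ofReal_mul (by norm_num)]
  refine le_mul_of_one_le_left' ?_
  rw [← ENNReal.ofReal_one]
  apply ENNReal.ofReal_le_ofReal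
  linarith [h.le_abs_det u]

end SmallField

lemma lintegral_comp_mul_left_complex {c : ℂ} (hc : c ≠ 0) (G : ℂ → ℝ≥0∞) :
    ENNReal.ofReal (‖c‖ ^ 2) * ∫⁻ u, G (c * u) = ∫⁻ u, G u := by
  have hd (u : ℂ) : HasFDerivAt (fun u : ℂ => c * u) (ContinuousLinearMap.mul ℝ ℂ c) u :=
    (ContinuousLinearMap.mul ℝ ℂ c).hasFDerivAt
  have := lintegral_image_eq_lintegral_abs_det_fderiv_mul volume MeasurableSet.univ
    (fun u _ => (hd u).hasFDerivWithinAt) (mul_right_injective₀ hc).injOn G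
  rw [Set.image_univ, (mul_left_surjective₀ hc).range_eq] at this
  rw [← lintegral_const_mul' _ _ ENNReal.ofReal_ne_top]
  have hdet : |(ContinuousLinearMap.mul ℝ ℂ c).det| = ‖c‖ ^ 2 := by
    rw [det_eq, ← Complex.normSq_eq_norm_sq, Complex.normSq_apply]
    simp only [ContinuousLinearMap.mul_apply', mul_one, Complex.mul_im, Complex.mul_re,
      Complex.I_re, Complex.I_im, mul_zero, zero_sub, add_zero]
    rw [abs_of_nonneg (by nlinarith [sq_nonneg c.re, sq_nonneg c.im])]
    ring
  simpa [hdet] using this.symm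

lemma lintegral_comp_mul_deform_le {τ : ℂ → ℂ} {ε : ℝ} (h : SmallField τ ε) {c : ℂ} (hc : c ≠ 0)
    (z : ℂ) (G : ℂ → ℝ≥0∞) :
    ENNReal.ofReal (‖c‖ ^ 2) * ∫⁻ u, G (c * (z - (u - τ u)))
      ≤ ENNReal.ofReal (25 / 14) * ∫⁻ u, G u := by
  rw [← lintegral_comp_mul_left_complex hc G, mul_left_comm]
  refine mul_le_mul_right ?_ _
  refine (h.lintegral_comp_le fun u => G (c * (z - u))).trans_eq ?_
  rw [lintegral_sub_left_eq_self (fun u => G (c * u)) z]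

/-! ### Increments of functions supported in the disk -/

/-- A line meets the circle at most twice; the second parameter comes from Vieta's formula. These
are the points where a function cut off at the circle may fail to be differentiable along the line.
-/
lemma countable_norm_line_eq_one (a d : ℂ) (hd : d ≠ 0) :
    {s : ℝ | ‖a + s * d‖ = 1}.Countable := by
  by_cases hne : {s : ℝ | ‖a + s * d‖ = 1}.Nonempty
  · obtain ⟨s₁, h₁⟩ := hne
    refine (Set.toFinite {s₁, -s₁ - 2 * (a.re * d.re + a.im * d.im) / Complex.normSq d}).countable.mono
      fun s hs => ?_
    have hN : Complex.normSq d ≠ 0 := by simpa using hd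
    have e (s : ℝ) (hs : ‖a + s * d‖ = 1) :
        (a.re + s * d.re) ^ 2 + (a.im + s * d.im) ^ 2 = 1 := by
      have := Complex.normSq_eq_norm_sq (a + s * d)
      rw [hs, Complex.normSq_apply] at this
      simp at this; linarith
    have e1 := e s₁ h₁
    have e2 := e s hs
    have : (s - s₁) * ((s + s₁) * Complex.normSq d + 2 * (a.re * d.re + a.im * d.im)) = 0 := by
      rw [Complex.normSq_apply]; linear_combination e2 - e1
    rcases mul_eq_zero.1 this with h | h
    · left; linarith
    · right
      simp only [Set.mem_singleton_iff]
      field_simp; linarith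
  · rw [Set.not_nonempty_iff_eq_empty.1 hne]; exact Set.countable_empty

lemma continuous_indicator_unitDisk {S : ℂ → ℝ} (hS : Continuous S)
    (h0 : ∀ v : ℂ, ‖v‖ = 1 → S v = 0) : Continuous (unitDisk.indicator S) := by
  refine continuous_indicator (fun v hv => h0 v ?_) hS.continuousOn
  rw [frontier_closedBall _ one_ne_zero] at hv
  simpa using hv

/-- The truncation of `S` is continuous, because `S` vanishes on the circle, and differentiable
along the segment off a countable set. The fundamental theorem of calculus applies, and only points
inside the disk contribute. -/
lemma enorm_indicator_sub_le {S : ℂ → ℝ} (hS : ContDiff ℝ 1 S)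
    (h0 : ∀ v : ℂ, ‖v‖ = 1 → S v = 0) (a d : ℂ) :
    ‖unitDisk.indicator S (a + d) - unitDisk.indicator S a‖ₑ ≤
      ∫⁻ s : ℝ in Set.Icc 0 1, unitDisk.indicator (fun v => ‖fderiv ℝ S v‖ₑ) (a + s * d) * ‖d‖ₑ := by
  by_cases hd : d = 0
  · simp [hd]
  set f' : ℝ → ℝ := fun s => unitDisk.indicator (fun v => fderiv ℝ S v d) (a + s * d) with hf'
  have hline : Continuous fun s : ℝ => a + (s : ℂ) * d := by fun_prop
  have hgc := continuous_fderiv_apply hS d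
  have hmeas : Measurable f' :=
    (hgc.measurable.indicator Metric.isClosed_closedBall.measurableSet).comp hline.measurable
  obtain ⟨C, hC⟩ := (isCompact_closedBall (0 : ℂ) 1).exists_bound_of_continuousOn hgc.continuousOn
  have hC0 : 0 ≤ C := (norm_nonneg _).trans (hC 0 (by simp))
  have hint : IntervalIntegrable f' volume 0 1 := by
    refine (intervalIntegrable_const (c := C)).mono_fun hmeas.aestronglyMeasurable
      (Eventually.of_forall fun s => ?_)
    simp only [hf', Real.norm_of_nonneg hC0]
    by_cases hs : a + (s : ℂ) * d ∈ unitDisk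
    · rw [Set.indicator_of_mem hs]; exact hC _ hs
    · rw [Set.indicator_of_notMem hs]; simpa using hC0
  have hftc := integral_eq_of_hasDerivAt_off_countable
    (fun s : ℝ => unitDisk.indicator S (a + s * d)) f' (a := 0) (b := 1)
    (countable_norm_line_eq_one a d hd)
    ((continuous_indicator_unitDisk hS.continuous h0).comp hline).continuousOn ?_ hint
  · have e : unitDisk.indicator S (a + d) - unitDisk.indicator S a = ∫ s in (0 : ℝ)..1, f' s := by
      rw [hftc]; simp
    rw [e, intervalIntegral.integral_of_le zero_le_one, ← integral_Icc_eq_integral_Ioc]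
    refine (enorm_integral_le_lintegral_enorm _).trans (lintegral_mono fun s => ?_)
    simp only [hf']
    by_cases hs : a + (s : ℂ) * d ∈ unitDisk
    · rw [Set.indicator_of_mem hs, Set.indicator_of_mem hs]
      exact ContinuousLinearMap.le_opENorm _ _
    · rw [Set.indicator_of_notMem hs, Set.indicator_of_notMem hs]; simp
  · intro s hs
    have hne : ‖a + (s : ℂ) * d‖ ≠ 1 := hs.2
    have hl : HasDerivAt (fun s : ℝ => a + (s : ℂ) * d) d s := by
      simpa using ((Complex.ofRealCLM.hasDerivAt (x := s)).mul_const d).const_add a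
    rcases lt_or_gt_of_ne hne with h | h
    · have hmem : a + (s : ℂ) * d ∈ unitDisk := by simpa using h.le
      have hnear : ∀ᶠ x : ℝ in 𝓝 s, ‖a + (x : ℂ) * d‖ < 1 :=
        (hline.norm.continuousAt).eventually_lt_const h
      simp only [hf', Set.indicator_of_mem hmem]
      refine (((hS.differentiable (by simp)).differentiableAt.hasFDerivAt).comp_hasDerivAt s
        hl).congr_of_eventuallyEq ?_
      filter_upwards [hnear] with x hx
      exact Set.indicator_of_mem (by simpa using hx.le) _
    · have hmem : a + (s : ℂ) * d ∉ unitDisk := by simpa using h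
      have hnear : ∀ᶠ x : ℝ in 𝓝 s, 1 < ‖a + (x : ℂ) * d‖ :=
        (hline.norm.continuousAt).eventually_const_lt h
      simp only [hf', Set.indicator_of_notMem hmem]
      refine (hasDerivAt_const s (0 : ℝ)).congr_of_eventuallyEq ?_
      filter_upwards [hnear] with x hx
      exact Set.indicator_of_notMem (by simpa using hx) _

/-- The segment between the two arguments runs through the deformations by `s τ`, `0 ≤ s ≤ 1`, which
satisfy the same bounds as `τ`. Where it lies in the disk, `‖c‖ ‖z - u‖ ≤ 5/4`, so the displacement
is at most `5/4 ε` whatever `c` is. The change of variables at time `s` costs `25/14`, and `5/4 ·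
25/14 = 125/56`. -/
lemma lintegral_enorm_indicator_deform_sub_le {τ : ℂ → ℂ} {ε : ℝ} (h : SmallField τ ε)
    {S : ℂ → ℝ} (hS : ContDiff ℝ 1 S) (h0 : ∀ v : ℂ, ‖v‖ = 1 → S v = 0) {c : ℂ} (hc : c ≠ 0)
    (z : ℂ) :
    ENNReal.ofReal (‖c‖ ^ 2) * ∫⁻ u, ‖unitDisk.indicator S (c * ((z - τ z) - (u - τ u)))
        - unitDisk.indicator S (c * (z - u))‖ₑ
      ≤ ENNReal.ofReal (125 / 56 * ε) * ∫⁻ v in unitDisk, ‖fderiv ℝ S v‖ₑ := by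
  set g : ℂ → ℝ≥0∞ := unitDisk.indicator fun v => ‖fderiv ℝ S v‖ₑ with hg
  have hgm : Measurable g := ((hS.continuous_fderiv (by simp)).enorm.measurable).indicator
    Metric.isClosed_closedBall.measurableSet
  have hpt (u : ℂ) : ‖unitDisk.indicator S (c * ((z - τ z) - (u - τ u)))
        - unitDisk.indicator S (c * (z - u))‖ₑ
      ≤ ∫⁻ s : ℝ in Set.Icc 0 1,
        ENNReal.ofReal (5 / 4 * ε) * g (c * ((z - s * τ z) - (u - s * τ u))) := by
    have h1 := enorm_indicator_sub_le hS h0 (c * (z - u)) (-(c * (τ z - τ u)))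
    rw [show c * (z - u) + -(c * (τ z - τ u)) = c * ((z - τ z) - (u - τ u)) by ring] at h1
    refine h1.trans (setLIntegral_mono' measurableSet_Icc fun s hs => ?_)
    rw [show c * (z - u) + (s : ℂ) * -(c * (τ z - τ u)) = c * ((z - s * τ z) - (u - s * τ u)) by
      ring]
    by_cases hm : c * ((z - s * τ z) - (u - s * τ u)) ∈ unitDisk
    · rw [mul_comm]
      refine mul_le_mul_left ?_ _
      rw [← ofReal_norm]
      apply ENNReal.ofReal_le_ofReal
      have h2 := (h.smul hs.1 hs.2).norm_deform_sub_ge z u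
      have h3 := h.norm_sub_le z u
      have h4 : ‖c‖ * ‖(z - s * τ z) - (u - s * τ u)‖ ≤ 1 := by simpa using hm
      rw [norm_neg, norm_mul]
      have h5 : ‖τ z - τ u‖ ≤ 5 / 4 * ε * ‖(z - s * τ z) - (u - s * τ u)‖ := by
        nlinarith [h.nonneg]
      nlinarith [h.nonneg, norm_nonneg c]
    · rw [hg, Set.indicator_of_notMem hm]; simp
  refine (mul_le_mul_right (lintegral_mono hpt) _).trans ?_
  rw [lintegral_lintegral_swap]
  · simp only [lintegral_const_mul' _ _ ENNReal.ofReal_ne_top]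
    rw [← mul_assoc, mul_comm (ENNReal.ofReal (‖c‖ ^ 2)), mul_assoc,
      ← lintegral_const_mul' _ _ ENNReal.ofReal_ne_top,
      show 125 / 56 * ε = (5 / 4 * ε) * (25 / 14) by ring,
      ENNReal.ofReal_mul (p := 5 / 4 * ε) (by linarith [h.nonneg]), mul_assoc]
    refine mul_le_mul_right ?_ _
    rw [← lintegral_indicator Metric.isClosed_closedBall.measurableSet]
    calc _ ≤ ∫⁻ _ in Set.Icc (0 : ℝ) 1, ENNReal.ofReal (25 / 14) * ∫⁻ v, g v :=
          setLIntegral_mono' measurableSet_Icc fun s hs =>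
            lintegral_comp_mul_deform_le (h.smul hs.1 hs.2) hc (z - s * τ z) g
      _ = _ := by simp [hg]
  · refine Measurable.aemeasurable ?_
    have := h.contDiff.continuous
    refine (hgm.comp ?_).const_mul _
    exact Continuous.measurable (f := fun p : ℂ × ℝ => c * ((z - p.2 * τ z) - (p.1 - p.2 * τ p.1)))
      (by fun_prop)

/-! ### Integral bounds for filters -/

/-- `κ` bounds the `L¹` norm of the filter `W` and, up to a factor proportional to `ε`, the `L¹`
distance between `W` and its composition with the deformation `u ↦ u - τ(u)`. -/
structure FilterBound (τ : ℂ → ℂ) (ε : ℝ) (W : ℂ × S1 → ℝ) (κ : ℝ≥0∞) : Prop where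
  norm_le : ∫⁻ p, ‖W p‖ₑ ∂jointMeasure ≤ κ
  deform_le : ∀ c : S1 → ℂ, Measurable c → (∀ β, ‖c β‖ = 1) → ∀ z,
    ∫⁻ β, (∫⁻ u, ‖W (c β * ((z - τ z) - (u - τ u)), β) - W (c β * (z - u), β)‖ₑ) ∂circleMeasure
      ≤ ENNReal.ofReal (125 / 56 * ε) * κ

/-- The filter given by a finite Fourier-Bessel expansion. -/
noncomputable def fbFilter (j : ℝ) (s : Finset (FBIndex × ℤ)) (a : FBIndex × ℤ → ℝ)
    (p : ℂ × S1) : ℝ :=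
  ∑ q ∈ s, a q * (fbScaled j q.1 p.1 * circleBasis q.2 p.2)

lemma fbFilter_eq (j : ℝ) (s : Finset (FBIndex × ℤ)) (a : FBIndex × ℤ → ℝ) (p : ℂ × S1) :
    fbFilter j s a p = ((2 : ℝ) ^ (-j)) ^ 2 *
      unitDisk.indicator (fbSum s a p.2) ((((2 : ℝ) ^ (-j) : ℝ) : ℂ) * p.1) := by
  have h2 : (2 : ℝ) ^ (-2 * j) = ((2 : ℝ) ^ (-j)) ^ 2 := by
    rw [← Real.rpow_natCast, ← Real.rpow_mul (by norm_num)]; congr 1; push_cast; ring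
  unfold fbFilter fbScaled
  simp only [fbBasis_eq, h2]
  by_cases hv : (((2 : ℝ) ^ (-j) : ℝ) : ℂ) * p.1 ∈ unitDisk
  · simp only [Set.indicator_of_mem hv, fbSum, Finset.mul_sum]
    exact Finset.sum_congr rfl fun q _ => by ring
  · simp only [Set.indicator_of_notMem hv]
    simp

lemma measurable_fbFilter (j : ℝ) (s : Finset (FBIndex × ℤ)) (a : FBIndex × ℤ → ℝ) :
    Measurable (fbFilter j s a) := by
  refine Finset.measurable_fun_sum _ fun q _ => measurable_const.mul (Measurable.mul ?_
    ((continuous_circleBasis _).measurable.comp measurable_snd))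
  have : Measurable (fbBasis q.1) := by
    rw [show fbBasis q.1 = _ from funext (fbBasis_eq q.1)]
    exact ((contDiff_fbSmooth 0 q.1).continuous.measurable).indicator
      Metric.isClosed_closedBall.measurableSet
  exact (this.comp (measurable_fst.const_mul _)).const_mul _

/-- The prefactor `2^(-2j)` is the Jacobian of the dilation, so neither bound depends on the scale.
The unimodular factor `c β` does not change the Jacobian. -/
lemma filterBound_fbFilter {τ : ℂ → ℂ} {ε : ℝ} (h : SmallField τ ε) (j : ℝ)
    (s : Finset (FBIndex × ℤ)) (a : FBIndex × ℤ → ℝ) :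
    FilterBound τ ε (fbFilter j s a) (ENNReal.ofReal (Real.pi * √(fbEnergy s a))) := by
  set r : ℝ := (2 : ℝ) ^ (-j) with hr
  have hr0 : 0 < r := by positivity
  constructor
  · rw [lintegral_prod_symm _ (measurable_fbFilter j s a).enorm.aemeasurable]
    refine le_trans (le_of_eq (lintegral_congr fun β => ?_)) (lintegral_enorm_fbSum_le s a)
    have h1 := lintegral_comp_mul_left_complex (c := (r : ℂ)) (by exact_mod_cast hr0.ne')
      fun v => ‖unitDisk.indicator (fbSum s a β) v‖ₑ
    simp only [fbFilter_eq, enorm_mul, ← hr]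
    rw [lintegral_const_mul' _ _ enorm_ne_top, ← lintegral_indicator
      Metric.isClosed_closedBall.measurableSet]
    simp only [enorm_indicator_eq_indicator_enorm] at h1 ⊢
    rw [← h1, Complex.norm_real, Real.norm_of_nonneg hr0.le, Real.enorm_of_nonneg (by positivity)]
  · intro c _ hc1 z
    refine le_trans (lintegral_mono fun β => ?_) ((lintegral_const_mul' _ _
      ENNReal.ofReal_ne_top).trans_le (mul_le_mul_right (lintegral_enorm_fderiv_fbSum_le s a) _))
    have hc0 : c β ≠ 0 := by rw [← norm_ne_zero_iff, hc1]; exact one_ne_zero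
    have h1 := lintegral_enorm_indicator_deform_sub_le h (contDiff_fbSum 1 s a β)
      (fun v hv => fbSum_eq_zero s a β hv) (c := r * c β)
      (mul_ne_zero (by exact_mod_cast hr0.ne') hc0) z
    refine le_trans (le_of_eq ?_) h1
    rw [← lintegral_const_mul' _ _ ENNReal.ofReal_ne_top]
    refine lintegral_congr fun u => ?_
    simp only [fbFilter_eq, ← hr, mul_assoc]
    rw [← mul_sub, enorm_mul, Real.enorm_of_nonneg (by positivity), norm_mul, hc1, mul_one,
      Complex.norm_real, Real.norm_of_nonneg hr0.le]

lemma FilterBound.mono {τ : ℂ → ℂ} {ε : ℝ} {W : ℂ × S1 → ℝ} {κ κ' : ℝ≥0∞}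
    (h : FilterBound τ ε W κ) (hκ : κ ≤ κ') : FilterBound τ ε W κ' :=
  ⟨h.norm_le.trans hκ, fun c hc h1 z =>
    (h.deform_le c hc h1 z).trans (mul_le_mul_right hκ _)⟩

/-- Both bounds are stable under `L¹` limits, since composition with the deformation is bounded on
`L¹`. No derivative of the limit filter is needed. -/
lemma FilterBound.of_approx {τ : ℂ → ℂ} {ε : ℝ} (hτ : SmallField τ ε) {W : ℂ × S1 → ℝ}
    (hW : Measurable W) {κ : ℝ≥0∞}
    (h : ∀ δ : ℝ≥0∞, 0 < δ → ∃ V : ℂ × S1 → ℝ, Measurable V ∧ FilterBound τ ε V κ ∧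
      ∫⁻ p, ‖W p - V p‖ₑ ∂jointMeasure ≤ δ) : FilterBound τ ε W κ := by
  have hτc := hτ.contDiff.continuous.measurable
  constructor
  · refine ENNReal.le_of_forall_pos_le_add fun δ hδ _ => ?_
    obtain ⟨V, hV, hVκ, hd⟩ := h δ (by exact_mod_cast hδ)
    calc ∫⁻ p, ‖W p‖ₑ ∂jointMeasure ≤ ∫⁻ p, (‖V p‖ₑ + ‖W p - V p‖ₑ) ∂jointMeasure := by
          refine lintegral_mono fun p => ?_
          simpa using enorm_add_le (V p) (W p - V p)
      _ ≤ _ := by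
          rw [lintegral_add_left hV.enorm]
          exact add_le_add hVκ.norm_le hd
  · intro c hc h1 z
    have hc0 (β : S1) : c β ≠ 0 := by rw [← norm_ne_zero_iff, h1]; exact one_ne_zero
    refine ENNReal.le_of_forall_pos_le_add fun δ hδ _ => ?_
    -- The deformed error counts at most twice (`25/14 ≤ 2`) and the undeformed one once: three
    -- quarters of `δ` in all.
    have hδ4 : (0 : ℝ≥0∞) < (δ : ℝ≥0∞) / 4 := ENNReal.div_pos (by exact_mod_cast hδ.ne') (by simp)
    obtain ⟨V, hV, hVκ, hd⟩ := h (δ / 4) hδ4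
    set E : ℂ × S1 → ℝ := fun p => W p - V p with hE
    have hEm : Measurable E := hW.sub hV
    have hm₁ : Measurable fun p : S1 × ℂ => (c p.1 * ((z - τ z) - (p.2 - τ p.2)), p.1) := by
      fun_prop
    have hm₂ : Measurable fun p : S1 × ℂ => (c p.1 * (z - p.2), p.1) := by fun_prop
    have hE1 (β : S1) : ∫⁻ u, ‖E (c β * ((z - τ z) - (u - τ u)), β)‖ₑ
        ≤ 2 * ∫⁻ v, ‖E (v, β)‖ₑ := by
      have := lintegral_comp_mul_deform_le hτ (hc0 β) (z - τ z) fun v => ‖E (v, β)‖ₑ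
      rw [h1, one_pow, ENNReal.ofReal_one, one_mul] at this
      refine this.trans (mul_le_mul_left ?_ _)
      rw [show (2 : ℝ≥0∞) = ENNReal.ofReal 2 by simp]
      exact ENNReal.ofReal_le_ofReal (by norm_num)
    have hE2 (β : S1) : ∫⁻ u, ‖E (c β * (z - u), β)‖ₑ = ∫⁻ v, ‖E (v, β)‖ₑ := by
      rw [lintegral_sub_left_eq_self (fun u => ‖E (c β * u, β)‖ₑ) z]
      have := lintegral_comp_mul_left_complex (hc0 β) fun v => ‖E (v, β)‖ₑ
      rwa [h1, one_pow, ENNReal.ofReal_one, one_mul] at this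
    have hEi : ∫⁻ β, (∫⁻ v, ‖E (v, β)‖ₑ) ∂circleMeasure ≤ δ / 4 := by
      rw [← lintegral_prod_symm _ hEm.enorm.aemeasurable]; exact hd
    calc _ ≤ ∫⁻ β, (∫⁻ u, (‖V (c β * ((z - τ z) - (u - τ u)), β) - V (c β * (z - u), β)‖ₑ +
            (‖E (c β * ((z - τ z) - (u - τ u)), β)‖ₑ + ‖E (c β * (z - u), β)‖ₑ)))
            ∂circleMeasure := by
          refine lintegral_mono fun β => lintegral_mono fun u => ?_
          refine le_trans ?_ (add_le_add_right (enorm_sub_le) _)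
          refine le_trans (le_of_eq ?_) (enorm_add_le _ _)
          simp only [hE]; congr 1; ring
      _ = ∫⁻ β, ((∫⁻ u, ‖V (c β * ((z - τ z) - (u - τ u)), β) - V (c β * (z - u), β)‖ₑ) +
            ((∫⁻ u, ‖E (c β * ((z - τ z) - (u - τ u)), β)‖ₑ) +
              ∫⁻ u, ‖E (c β * (z - u), β)‖ₑ)) ∂circleMeasure := by
          refine lintegral_congr fun β => ?_
          rw [lintegral_add_left, lintegral_add_left]
          · exact (hEm.comp (hm₁.comp (measurable_prodMk_left (x := β)))).enorm
          · exact ((hV.comp (hm₁.comp (measurable_prodMk_left (x := β)))).sub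
              (hV.comp (hm₂.comp (measurable_prodMk_left (x := β))))).enorm
      _ ≤ ∫⁻ β, ((∫⁻ u, ‖V (c β * ((z - τ z) - (u - τ u)), β) - V (c β * (z - u), β)‖ₑ) +
            3 * ∫⁻ v, ‖E (v, β)‖ₑ) ∂circleMeasure := by
          refine lintegral_mono fun β => add_le_add_right ?_ _
          rw [hE2]
          refine (add_le_add_left (hE1 β) _).trans (le_of_eq ?_)
          ring
      _ ≤ _ := by
          rw [lintegral_add_left, lintegral_const_mul' _ _ (by simp)]
          · refine add_le_add (hVκ.deform_le c hc h1 z) ?_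
            refine (mul_le_mul_right hEi 3).trans ?_
            refine (mul_le_mul_left (show (3 : ℝ≥0∞) ≤ 4 by norm_num) _).trans (le_of_eq ?_)
            exact ENNReal.mul_div_cancel (by simp) (by simp)
          · exact Measurable.lintegral_prod_right'
              (f := fun p : S1 × ℂ => ‖V (c p.1 * ((z - τ z) - (p.2 - τ p.2)), p.1)
                - V (c p.1 * (z - p.2), p.1)‖ₑ) ((hV.comp hm₁).sub (hV.comp hm₂)).enorm

/-- Convergence in `L²` of functions supported in a fixed set of finite measure implies
convergence in `L¹`. -/
lemma tendsto_lintegral_enorm_of_eLpNorm_two {α ι : Type*} [MeasurableSpace α] {μ : Measure α}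
    {l : Filter ι} [l.NeBot] {W : α → ℝ} {V : ι → α → ℝ} (hW : Measurable W)
    (hV : ∀ i, Measurable (V i)) {K : Set α} (hK : MeasurableSet K) (hKμ : μ K ≠ ∞)
    (hsupp : ∀ i, ∀ x ∉ K, V i x = 0)
    (h : Tendsto (fun i => eLpNorm (fun x => W x - V i x) 2 μ) l (𝓝 0)) :
    Tendsto (fun i => ∫⁻ x, ‖W x - V i x‖ₑ ∂μ) l (𝓝 0) := by
  -- Off `K` all approximants vanish, so the norm of `W` there is below every approximation error.
  have hout : eLpNorm W 2 (μ.restrict Kᶜ) = 0 := by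
    refine le_antisymm (ge_of_tendsto h (Eventually.of_forall fun i => ?_)) zero_le
    refine le_trans (le_of_eq (eLpNorm_congr_ae ?_))
      (eLpNorm_mono_measure (fun x => W x - V i x) Measure.restrict_le_self)
    filter_upwards [ae_restrict_mem hK.compl] with x hx
    rw [hsupp i x hx, sub_zero]
  have hWz : W =ᵐ[μ.restrict Kᶜ] 0 :=
    (eLpNorm_eq_zero_iff hW.aestronglyMeasurable (by norm_num)).1 hout
  have hle (i : ι) : ∫⁻ x, ‖W x - V i x‖ₑ ∂μ
      ≤ eLpNorm (fun x => W x - V i x) 2 μ * μ K ^ (1 / 2 : ℝ) := by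
    rw [← lintegral_add_compl _ hK]
    have h0 : ∫⁻ x in Kᶜ, ‖W x - V i x‖ₑ ∂μ = 0 := by
      rw [lintegral_eq_zero_iff (f := fun x => ‖W x - V i x‖ₑ) (hW.sub (hV i)).enorm]
      filter_upwards [ae_restrict_mem hK.compl, hWz] with x hx hx0
      simp [hsupp i x hx, hx0]
    rw [h0, add_zero, ← eLpNorm_one_eq_lintegral_enorm]
    refine (eLpNorm_le_eLpNorm_mul_rpow_measure_univ (p := 1) (q := 2) (by norm_num)
      (hW.sub (hV i)).aestronglyMeasurable).trans ?_
    rw [Measure.restrict_apply_univ]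
    have : (1 / (1 : ℝ≥0∞).toReal - 1 / (2 : ℝ≥0∞).toReal) = 1 / 2 := by norm_num
    rw [this]
    exact mul_le_mul_left (eLpNorm_mono_measure _ Measure.restrict_le_self) _
  refine tendsto_of_tendsto_of_tendsto_of_le_of_le tendsto_const_nhds ?_ (fun i => zero_le) hle
  have := ENNReal.Tendsto.mul_const (b := μ K ^ (1 / 2 : ℝ)) h
    (Or.inr (ENNReal.rpow_ne_top_of_nonneg (by norm_num) hKμ))
  simpa using this

lemma fbScaled_eq_zero {j : ℝ} {k : FBIndex} {v : ℂ} (hv : v ∉ Metric.closedBall (0 : ℂ) (2 ^ j)) :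
    fbScaled j k v = 0 := by
  unfold fbScaled
  rw [fbBasis_eq, Set.indicator_of_notMem, mul_zero]
  simp only [mem_closedBall_zero_iff, not_le, norm_mul, Complex.norm_real] at hv ⊢
  have h2 : (0 : ℝ) < 2 ^ j := by positivity
  rw [Real.rpow_neg (by norm_num), norm_inv, Real.norm_of_nonneg h2.le]
  rwa [← div_eq_inv_mul, one_lt_div h2]

lemma ofReal_pi_mul_sqrt_fbEnergy_le (s : Finset (FBIndex × ℤ)) (a : FBIndex → ℤ → ℝ) :
    ENNReal.ofReal (Real.pi * √(fbEnergy s fun q => a q.1 q.2))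
      ≤ ENNReal.ofReal Real.pi * fbNormJoint a := by
  have h0 (k : FBIndex) (x : ℝ) : 0 ≤ fbEigenvalue k * x ^ 2 :=
    mul_nonneg (sq_nonneg _) (sq_nonneg _)
  rw [ENNReal.ofReal_mul Real.pi_pos.le]
  refine mul_le_mul_right ?_ _
  rw [fbEnergy, Real.sqrt_eq_rpow, ← ENNReal.ofReal_rpow_of_nonneg
    (Finset.sum_nonneg fun q _ => h0 _ _) (by norm_num), fbNormJoint]
  refine ENNReal.rpow_le_rpow ?_ (by norm_num)
  rw [ENNReal.ofReal_sum_of_nonneg fun q _ => h0 _ _, ← ENNReal.tsum_prod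
    (f := fun k m => ENNReal.ofReal (fbEigenvalue k * a k m ^ 2))]
  exact ENNReal.sum_le_tsum (f := fun q : FBIndex × ℤ =>
    ENNReal.ofReal (fbEigenvalue q.1 * a q.1 q.2 ^ 2)) s

lemma IsJointExpansion.filterBound {τ : ℂ → ℂ} {ε : ℝ} (hτ : SmallField τ ε) {j : ℝ}
    {a : FBIndex → ℤ → ℝ} {W : ℂ → S1 → ℝ} (h : IsJointExpansion j a W)
    {W' : ℂ × S1 → ℝ} (hW' : Measurable W') (hWW : (fun p => W p.1 p.2) =ᵐ[jointMeasure] W') :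
    FilterBound τ ε W' (ENNReal.ofReal Real.pi * fbNormJoint a) := by
  have ht := tendsto_lintegral_enorm_of_eLpNorm_two (μ := jointMeasure) (l := atTop) (W := W')
    (V := fun s => fbFilter j s fun q => a q.1 q.2) hW' (fun s => measurable_fbFilter _ _ _)
    (K := Metric.closedBall (0 : ℂ) (2 ^ j) ×ˢ Set.univ)
    (Metric.isClosed_closedBall.measurableSet.prod MeasurableSet.univ) ?_ ?_ ?_
  · refine FilterBound.of_approx hτ hW' fun δ hδ => ?_
    obtain ⟨s, hs⟩ := ((tendsto_order.1 ht).2 δ hδ).exists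
    exact ⟨_, measurable_fbFilter _ _ _, (filterBound_fbFilter hτ j s _).mono
      (ofReal_pi_mul_sqrt_fbEnergy_le s a), hs.le⟩
  · rw [Measure.prod_prod]
    exact ENNReal.mul_ne_top (isCompact_closedBall _ _).measure_ne_top (by simp)
  · intro s p hp
    refine Finset.sum_eq_zero fun q _ => ?_
    rw [fbScaled_eq_zero (fun hv => hp ⟨hv, trivial⟩)]; simp
  · refine h.2.congr fun s => eLpNorm_congr_ae ?_
    filter_upwards [hWW] with p hp
    rw [← hp]; rfl

lemma IsPlaneExpansion.filterBound {τ : ℂ → ℂ} {ε : ℝ} (hτ : SmallField τ ε) {j : ℝ}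
    {a : FBIndex → ℝ} {W : ℂ → ℝ} (h : IsPlaneExpansion j a W)
    {W' : ℂ → ℝ} (hW' : Measurable W') (hWW : W =ᵐ[volume] W') :
    FilterBound τ ε (fun p => W' p.1) (ENNReal.ofReal Real.pi * fbNormPlane a) := by
  classical
  -- A plane filter is a joint filter constant in the angle: since `φ_0 = 1`, its coefficients sit
  -- at `m = 0`.
  set b : FBIndex → ℤ → ℝ := fun k m => if m = 0 then a k else 0 with hb
  have hnorm : fbNormPlane a = fbNormJoint b := by
    unfold fbNormPlane fbNormJoint
    congr 2; ext k
    rw [tsum_eq_single 0 (fun m hm => by simp [hb, hm])]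
    simp [hb]
  have hV (s : Finset FBIndex) (p : ℂ × S1) : fbFilter j (s ×ˢ {0}) (fun q => b q.1 q.2) p
      = ∑ k ∈ s, a k * fbScaled j k p.1 := by
    unfold fbFilter
    rw [Finset.sum_product]
    simp [hb, circleBasis]
  have hVm (s : Finset FBIndex) : Measurable fun v => ∑ k ∈ s, a k * fbScaled j k v := by
    have := (measurable_fbFilter j (s ×ˢ {0}) (fun q => b q.1 q.2)).comp
      (measurable_prodMk_right (y := (0 : S1)))
    simpa only [Function.comp_def, hV] using this
  have ht := tendsto_lintegral_enorm_of_eLpNorm_two (μ := volume) (l := atTop) (W := W')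
    (V := fun s v => ∑ k ∈ s, a k * fbScaled j k v) hW' hVm
    (K := Metric.closedBall (0 : ℂ) (2 ^ j))
    Metric.isClosed_closedBall.measurableSet (isCompact_closedBall _ _).measure_ne_top ?_ ?_
  · refine FilterBound.of_approx hτ (hW'.comp measurable_fst) fun δ hδ => ?_
    obtain ⟨s, hs⟩ := ((tendsto_order.1 ht).2 δ hδ).exists
    refine ⟨_, measurable_fbFilter _ _ _, (filterBound_fbFilter hτ j (s ×ˢ {0}) _).mono
      ((ofReal_pi_mul_sqrt_fbEnergy_le (s ×ˢ {0}) b).trans_eq (by rw [hnorm])), ?_⟩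
    simp only [hV]
    refine le_trans (le_of_eq ?_) hs.le
    have hm : Measurable fun p : ℂ × S1 => ‖W' p.1 - ∑ k ∈ s, a k * fbScaled j k p.1‖ₑ :=
      ((hW'.comp measurable_fst).sub ((hVm s).comp measurable_fst)).enorm
    refine (lintegral_prod _ hm.aemeasurable).trans ?_
    simp
  · intro s v hv
    exact Finset.sum_eq_zero fun k _ => by rw [fbScaled_eq_zero hv, mul_zero]
  · refine h.2.congr fun s => eLpNorm_congr_ae ?_
    filter_upwards [hWW] with p hp
    rw [← hp]

/-! ### Schur's test -/

lemma eLpNorm_two_sq {α : Type*} [MeasurableSpace α] {μ : Measure α} (f : α → ℝ) :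
    eLpNorm f 2 μ ^ 2 = ∫⁻ x, ‖f x‖ₑ ^ 2 ∂μ := by
  have := eLpNorm_nnreal_pow_eq_lintegral (μ := μ) (f := f) (p := 2) (by simp)
  simpa using this

/-- Cauchy-Schwarz for `1` and `f` with respect to the measure `K dμ`. -/
lemma sq_lintegral_mul_le {α : Type*} [MeasurableSpace α] {μ : Measure α} {K f : α → ℝ≥0∞}
    (hK : Measurable K) (hf : Measurable f) :
    (∫⁻ x, K x * f x ∂μ) ^ 2 ≤ (∫⁻ x, K x ∂μ) * ∫⁻ x, K x * f x ^ 2 ∂μ := by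
  have h := ENNReal.lintegral_mul_le_Lp_mul_Lq (μ.withDensity K) (p := 2) (q := 2)
    Real.HolderConjugate.two_two (f := fun _ => 1) (g := f) measurable_const.aemeasurable
    hf.aemeasurable
  simp only [ENNReal.one_rpow] at h
  rw [lintegral_withDensity_eq_lintegral_mul _ hK (by measurability),
    lintegral_withDensity_eq_lintegral_mul _ hK (by measurability),
    lintegral_withDensity_eq_lintegral_mul _ hK (by measurability)] at h
  simp only [Pi.mul_apply, mul_one, one_mul] at h
  refine (pow_le_pow_left' h 2).trans (le_of_eq ?_)
  rw [mul_pow, ← ENNReal.rpow_natCast, ← ENNReal.rpow_natCast, ← ENNReal.rpow_mul,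
    ← ENNReal.rpow_mul]
  norm_num

/-- Schur's test for a kernel with the same bound on rows and columns. -/
lemma lintegral_sq_lintegral_mul_le {α : Type*} [MeasurableSpace α] {μ : Measure α} [SFinite μ]
    {K : α → α → ℝ≥0∞} (hK : Measurable fun p : α × α => K p.1 p.2) {f : α → ℝ≥0∞}
    (hf : Measurable f) {C : ℝ≥0∞} (hrow : ∀ x, ∫⁻ y, K x y ∂μ ≤ C)
    (hcol : ∀ y, ∫⁻ x, K x y ∂μ ≤ C) :
    ∫⁻ x, (∫⁻ y, K x y * f y ∂μ) ^ 2 ∂μ ≤ C ^ 2 * ∫⁻ y, f y ^ 2 ∂μ := by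
  have hK1 (x : α) : Measurable (K x) := hK.comp measurable_prodMk_left
  calc _ ≤ ∫⁻ x, C * ∫⁻ y, K x y * f y ^ 2 ∂μ ∂μ :=
        lintegral_mono fun x => (sq_lintegral_mul_le (hK1 x) hf).trans
          (mul_le_mul_left (hrow x) _)
    _ = C * ∫⁻ y, ∫⁻ x, K x y * f y ^ 2 ∂μ ∂μ := by
        have hm : Measurable fun p : α × α => K p.1 p.2 * f p.2 ^ 2 :=
          hK.mul ((hf.comp measurable_snd).pow_const 2)
        rw [lintegral_const_mul _ hm.lintegral_prod_right',
          lintegral_lintegral_swap hm.aemeasurable]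
    _ ≤ C * ∫⁻ y, C * f y ^ 2 ∂μ := by
        refine mul_le_mul_right (lintegral_mono fun y => ?_) _
        simp only
        have hKy : Measurable fun x => K x y := hK.comp measurable_prodMk_right
        rw [lintegral_mul_const _ hKy]
        exact mul_le_mul_left (hcol y) _
    _ = _ := by rw [lintegral_const_mul _ (hf.pow_const 2)]; ring

lemma eLpNorm_le_of_schur {α : Type*} [MeasurableSpace α] {μ : Measure α} [SFinite μ]
    {K : α → α → ℝ≥0∞} (hK : Measurable fun p : α × α => K p.1 p.2) {f g : α → ℝ}
    (hf : Measurable f) {C : ℝ≥0∞} (hrow : ∀ x, ∫⁻ y, K x y ∂μ ≤ C)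
    (hcol : ∀ y, ∫⁻ x, K x y ∂μ ≤ C) (hg : ∀ᵐ x ∂μ, ‖g x‖ₑ ≤ ∫⁻ y, K x y * ‖f y‖ₑ ∂μ) :
    eLpNorm g 2 μ ≤ C * eLpNorm f 2 μ := by
  rw [← ENNReal.pow_le_pow_left_iff two_ne_zero, mul_pow, eLpNorm_two_sq, eLpNorm_two_sq]
  refine (lintegral_mono_ae ?_).trans (lintegral_sq_lintegral_mul_le hK hf.enorm hrow hcol)
  filter_upwards [hg] with x hx using pow_le_pow_left' hx 2

/-! ### The frame of a point of the plane times the circle -/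

lemma norm_toCircle (t : S1) : ‖(AddCircle.toCircle t : ℂ)‖ = 1 := Circle.norm_coe _

lemma toCircle_ne_zero (t : S1) : (AddCircle.toCircle t : ℂ) ≠ 0 := Circle.coe_ne_zero _

@[fun_prop]
lemma continuous_toCircle : Continuous fun t : S1 => (AddCircle.toCircle t : ℂ) :=
  Continuous.comp (g := ((↑) : Circle → ℂ)) continuous_subtype_val AddCircle.continuous_toCircle

/-- Coordinates of `q` relative to the position and orientation given by `P`. -/
noncomputable def frame (P q : ℂ × S1) : ℂ × S1 :=
  (AddCircle.toCircle P.2 * (q.1 - P.1), q.2 - P.2)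

lemma continuous_frame : Continuous fun p : (ℂ × S1) × (ℂ × S1) => frame p.1 p.2 := by
  unfold frame; fun_prop

lemma measurable_frame : Measurable fun p : (ℂ × S1) × (ℂ × S1) => frame p.1 p.2 :=
  continuous_frame.measurable

lemma lintegral_toCircle_mul (t : S1) (G : ℂ → ℝ≥0∞) :
    ∫⁻ u, G (AddCircle.toCircle t * u) = ∫⁻ u, G u := by
  have := lintegral_comp_mul_left_complex (toCircle_ne_zero t) G
  rwa [norm_toCircle, one_pow, ENNReal.ofReal_one, one_mul] at this

lemma lintegral_frame_right (P : ℂ × S1) {G : ℂ × S1 → ℝ≥0∞} (hG : Measurable G) :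
    ∫⁻ q, G (frame P q) ∂jointMeasure = ∫⁻ q, G q ∂jointMeasure := by
  have hm : Measurable fun q => G (frame P q) :=
    hG.comp (measurable_frame.comp measurable_prodMk_left)
  rw [lintegral_prod_symm _ hm.aemeasurable, lintegral_prod_symm _ hG.aemeasurable]
  simp only [frame]
  rw [lintegral_sub_right_eq_self
    (fun β => ∫⁻ u, G (AddCircle.toCircle P.2 * (u - P.1), β)) P.2]
  refine lintegral_congr fun β => ?_
  rw [lintegral_sub_right_eq_self (fun u => G (AddCircle.toCircle P.2 * u, β)) P.1,
    lintegral_toCircle_mul P.2 fun u => G (u, β)]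

/-- The orientation now varies with the integration variable, but at each fixed angle the plane
integral is invariant under rotation and reflection. Hence a convolution kernel has equal row and
column integrals. -/
lemma lintegral_frame_left (q : ℂ × S1) {G : ℂ × S1 → ℝ≥0∞} (hG : Measurable G) :
    ∫⁻ P, G (frame P q) ∂jointMeasure = ∫⁻ p, G p ∂jointMeasure := by
  have hm : Measurable fun P => G (frame P q) :=
    hG.comp (measurable_frame.comp measurable_prodMk_right)
  rw [lintegral_prod_symm _ hm.aemeasurable, lintegral_prod_symm _ hG.aemeasurable]
  simp only [frame]
  rw [← lintegral_sub_left_eq_self (fun β => ∫⁻ u, G (u, β) ∂volume) q.2]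
  refine lintegral_congr fun α => ?_
  rw [lintegral_sub_left_eq_self (fun u => G (AddCircle.toCircle α * u, q.2 - α)) q.1,
    lintegral_toCircle_mul α fun u => G (u, q.2 - α)]

lemma measurePreserving_frame (P : ℂ × S1) :
    MeasurePreserving (frame P) jointMeasure jointMeasure := by
  have hm : Measurable (frame P) := measurable_frame.comp measurable_prodMk_left
  refine ⟨hm, Measure.ext fun s hs => ?_⟩
  have := lintegral_frame_right P (measurable_one.indicator hs : Measurable (s.indicator 1))
  rw [← lintegral_indicator_one hs, ← lintegral_indicator_one hs, ← this,
    lintegral_map (measurable_one.indicator hs) hm]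

/-! ### The deformation on the plane times the circle -/

/-- The deformation `(u, α) ↦ (u - τ(u), α)`. -/
def deform (τ : ℂ → ℂ) (p : ℂ × S1) : ℂ × S1 := (p.1 - τ p.1, p.2)

/-- The Jacobian of the deformation `u ↦ u - τ(u)`. -/
noncomputable def deformJacobian (τ : ℂ → ℂ) (p : ℂ × S1) : ℝ :=
  |(ContinuousLinearMap.id ℝ ℂ - fderiv ℝ τ p.1).det|

namespace SmallField

variable {τ : ℂ → ℂ} {ε : ℝ}

lemma measurable_deform (h : SmallField τ ε) : Measurable (deform τ) :=
  (h.continuous.measurable.comp measurable_fst).prodMk measurable_snd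

lemma measurable_deformJacobian (h : SmallField τ ε) : Measurable (deformJacobian τ) := by
  have h1 := h.contDiff.continuous_fderiv (by simp)
  have h2 : Continuous fun u => (ContinuousLinearMap.id ℝ ℂ - fderiv ℝ τ u).det :=
    ContinuousLinearMap.continuous_det.comp (continuous_const.sub h1)
  exact (h2.abs.comp continuous_fst).measurable

lemma measurePreserving_deform (h : SmallField τ ε) :
    MeasurePreserving (deform τ)
      (jointMeasure.withDensity fun p => ENNReal.ofReal (deformJacobian τ p)) jointMeasure := by
  refine ⟨h.measurable_deform, Measure.ext fun s hs => ?_⟩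
  have hJ := h.measurable_deformJacobian.ennreal_ofReal
  have hi : Measurable (s.indicator (1 : ℂ × S1 → ℝ≥0∞)) := measurable_one.indicator hs
  have hiτ : Measurable fun p => s.indicator (1 : ℂ × S1 → ℝ≥0∞) (deform τ p) :=
    hi.comp h.measurable_deform
  rw [← lintegral_indicator_one hs, ← lintegral_indicator_one hs,
    lintegral_map hi h.measurable_deform,
    lintegral_withDensity_eq_lintegral_mul _ hJ hiτ,
    lintegral_prod_symm _ (hJ.mul hiτ).aemeasurable,
    lintegral_prod_symm _ hi.aemeasurable]
  refine lintegral_congr fun β => ?_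
  exact h.lintegral_comp_mul_det fun u => s.indicator 1 (u, β)

lemma lintegral_deform_le (h : SmallField τ ε) {G : ℂ × S1 → ℝ≥0∞} (hG : Measurable G) :
    ∫⁻ p, G (deform τ p) ∂jointMeasure
      ≤ ENNReal.ofReal (25 / 14) * ∫⁻ p, G p ∂jointMeasure := by
  have hm : Measurable fun p => G (deform τ p) := hG.comp h.measurable_deform
  rw [lintegral_prod_symm _ hm.aemeasurable,
    lintegral_prod_symm _ hG.aemeasurable, ← lintegral_const_mul' _ _ ENNReal.ofReal_ne_top]
  exact lintegral_mono fun β => h.lintegral_comp_le fun u => G (u, β)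

lemma quasiMeasurePreserving_deform (h : SmallField τ ε) :
    Measure.QuasiMeasurePreserving (deform τ) jointMeasure jointMeasure := by
  refine ⟨h.measurable_deform, Measure.AbsolutelyContinuous.mk fun s hs h0 => ?_⟩
  have hi : Measurable (s.indicator (1 : ℂ × S1 → ℝ≥0∞)) := measurable_one.indicator hs
  rw [← lintegral_indicator_one hs, lintegral_map hi h.measurable_deform]
  refine le_antisymm ((h.lintegral_deform_le hi).trans ?_) zero_le
  rw [lintegral_indicator_one hs, h0, mul_zero]

lemma eLpNorm_comp_deform_sq_le (h : SmallField τ ε) {f : ℂ × S1 → ℝ} (hf : Measurable f) :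
    eLpNorm (fun p => f (deform τ p)) 2 jointMeasure ^ 2
      ≤ ENNReal.ofReal (25 / 14) * eLpNorm f 2 jointMeasure ^ 2 := by
  rw [eLpNorm_two_sq, eLpNorm_two_sq]
  exact h.lintegral_deform_le (G := fun p => ‖f p‖ₑ ^ 2) (hf.enorm.pow_const 2)

lemma memLp_comp_deform (h : SmallField τ ε) {f : ℂ × S1 → ℝ} (hf : Measurable f)
    (hf2 : MemLp f 2 jointMeasure) : MemLp (fun p => f (deform τ p)) 2 jointMeasure := by
  refine ⟨(hf.comp h.measurable_deform).aestronglyMeasurable, ?_⟩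
  have h1 := (h.eLpNorm_comp_deform_sq_le hf).trans_lt
    (ENNReal.mul_lt_top ENNReal.ofReal_lt_top (ENNReal.pow_lt_top hf2.2))
  exact (ENNReal.pow_lt_top_iff.1 h1).resolve_right two_ne_zero

end SmallField

/-! ### Joint convolution -/

/-- The joint convolution of `x` with the filter `W`. -/
noncomputable def jointConv (W x : ℂ × S1 → ℝ) (P : ℂ × S1) : ℝ :=
  ∫ q, x q * W (frame P q) ∂jointMeasure

lemma measurable_jointConv {W x : ℂ × S1 → ℝ} (hW : Measurable W) (hx : Measurable x) :
    Measurable (jointConv W x) :=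
  (StronglyMeasurable.integral_prod_right' (f := fun p : (ℂ × S1) × (ℂ × S1) =>
    x p.2 * W (frame p.1 p.2)) ((hx.comp measurable_snd).mul
      (hW.comp measurable_frame)).stronglyMeasurable).measurable

/-- The value does not depend on `P`: this is why the response to a constant input stays constant
and drops out of the commutator. -/
lemma jointConv_const (W : ℂ × S1 → ℝ) (hW : Measurable W) (c : ℝ) (P : ℂ × S1) :
    jointConv W (fun _ => c) P = c * ∫ p, W p ∂jointMeasure := by
  unfold jointConv
  have h := integral_map (μ := jointMeasure) (f := W)
    (measurePreserving_frame P).measurable.aemeasurable hW.aestronglyMeasurable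
  rw [(measurePreserving_frame P).map_eq] at h
  rw [integral_const_mul, h]

namespace FilterBound

variable {τ : ℂ → ℂ} {ε : ℝ} {W : ℂ × S1 → ℝ} {κ : ℝ≥0∞}

lemma lintegral_row_le (h : FilterBound τ ε W κ) (hW : Measurable W) (P : ℂ × S1) :
    ∫⁻ q, ‖W (frame P q)‖ₑ ∂jointMeasure ≤ κ :=
  (lintegral_frame_right P hW.enorm).trans_le h.norm_le

lemma lintegral_col_le (h : FilterBound τ ε W κ) (hW : Measurable W) (q : ℂ × S1) :
    ∫⁻ P, ‖W (frame P q)‖ₑ ∂jointMeasure ≤ κ :=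
  (lintegral_frame_left q hW.enorm).trans_le h.norm_le

lemma measurable_kernel (hW : Measurable W) :
    Measurable fun p : (ℂ × S1) × (ℂ × S1) => ‖W (frame p.1 p.2)‖ₑ :=
  (hW.comp measurable_frame).enorm

lemma integrable_const (h : FilterBound τ ε W κ) (hW : Measurable W) (hκ : κ ≠ ∞) (c : ℝ)
    (P : ℂ × S1) : Integrable (fun q => c * W (frame P q)) jointMeasure :=
  Integrable.const_mul ⟨(hW.comp (measurable_frame.comp measurable_prodMk_left)).aestronglyMeasurable,
    (h.lintegral_row_le hW P).trans_lt hκ.lt_top⟩ c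

/-- The part `x - c` is handled by Schur's test, which makes its absolute convolution finite almost
everywhere; the constant part only needs `W` to be integrable. -/
lemma ae_integrable (h : FilterBound τ ε W κ) (hW : Measurable W) (hκ : κ ≠ ∞)
    {x : ℂ × S1 → ℝ} (hx : Measurable x) {c : ℝ} (hxc : MemLp (fun q => x q - c) 2 jointMeasure) :
    ∀ᵐ P ∂jointMeasure, Integrable (fun q => x q * W (frame P q)) jointMeasure := by
  have hxm : Measurable fun q => x q - c := hx.sub_const c
  have hk := measurable_kernel hW
  have h1 := lintegral_sq_lintegral_mul_le hk hxm.enorm (h.lintegral_row_le hW)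
    (h.lintegral_col_le hW)
  rw [← eLpNorm_two_sq] at h1
  have hmeas : Measurable fun P => (∫⁻ q, ‖W (frame P q)‖ₑ * ‖x q - c‖ₑ ∂jointMeasure) ^ 2 :=
    (Measurable.lintegral_prod_right' (f := fun p : (ℂ × S1) × (ℂ × S1) =>
      ‖W (frame p.1 p.2)‖ₑ * ‖x p.2 - c‖ₑ) (hk.mul (hxm.enorm.comp measurable_snd))).pow_const 2
  have h2 := ae_lt_top hmeas (h1.trans_lt (ENNReal.mul_lt_top
    (ENNReal.pow_lt_top hκ.lt_top) (ENNReal.pow_lt_top hxc.2))).ne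
  filter_upwards [h2] with P hP
  have h3 : Integrable (fun q => (x q - c) * W (frame P q)) jointMeasure := by
    refine ⟨(hxm.mul (hW.comp (measurable_frame.comp
      measurable_prodMk_left))).aestronglyMeasurable, ?_⟩
    refine lt_of_le_of_lt (le_of_eq ?_) ((ENNReal.pow_lt_top_iff.1 hP).resolve_right two_ne_zero)
    exact lintegral_congr fun q => by rw [enorm_mul, mul_comm]
  refine (h3.add (h.integrable_const hW hκ c P)).congr (Eventually.of_forall fun q => ?_)
  simp only [Pi.add_apply]; ring

lemma eLpNorm_jointConv_sub_le (h : FilterBound τ ε W κ) (hW : Measurable W) (hκ : κ ≠ ∞)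
    {x y : ℂ × S1 → ℝ} (hx : Measurable x) (hy : Measurable y) {c d : ℝ}
    (hxc : MemLp (fun q => x q - c) 2 jointMeasure)
    (hyd : MemLp (fun q => y q - d) 2 jointMeasure) :
    eLpNorm (fun P => jointConv W x P - jointConv W y P) 2 jointMeasure
      ≤ κ * eLpNorm (fun q => x q - y q) 2 jointMeasure := by
  refine eLpNorm_le_of_schur (f := fun q => x q - y q) (measurable_kernel hW) (hx.sub hy) (h.lintegral_row_le hW)
    (h.lintegral_col_le hW) ?_
  filter_upwards [h.ae_integrable hW hκ hx hxc, h.ae_integrable hW hκ hy hyd] with P h1 h2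
  unfold jointConv
  rw [← integral_sub h1 h2]
  refine (enorm_integral_le_lintegral_enorm _).trans (le_of_eq (lintegral_congr fun q => ?_))
  rw [← sub_mul, enorm_mul, mul_comm]

/-! ### Commutator of the joint convolution with the deformation -/

/-- Integration over `P` changes the orientation along with the relative angle. This is the reason
why `FilterBound.deform_le` admits a factor `c` depending on `β`; rows need only a constant one. -/
lemma lintegral_deform_col_le (h : FilterBound τ ε W κ) (hτ : SmallField τ ε) (hW : Measurable W)
    (q : ℂ × S1) :
    ∫⁻ P, ‖W (frame (deform τ P) (deform τ q)) - W (frame P q)‖ₑ ∂jointMeasure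
      ≤ ENNReal.ofReal (125 / 56 * ε) * κ := by
  have hm : Measurable fun P =>
      ‖W (frame (deform τ P) (deform τ q)) - W (frame P q)‖ₑ :=
    ((hW.comp (measurable_frame.comp (hτ.measurable_deform.prodMk measurable_const))).sub
      (hW.comp (measurable_frame.comp measurable_prodMk_right))).enorm
  rw [lintegral_prod_symm _ hm.aemeasurable,
    ← lintegral_sub_left_eq_self _ q.2]
  simp only [frame, deform, sub_sub_cancel]
  exact h.deform_le (fun β => AddCircle.toCircle (q.2 - β))
    (by exact Continuous.measurable (by fun_prop)) (fun β => norm_toCircle _) q.1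

lemma lintegral_deform_row_le (h : FilterBound τ ε W κ) (hτ : SmallField τ ε) (hW : Measurable W)
    (P : ℂ × S1) :
    ∫⁻ q, ‖W (frame (deform τ P) (deform τ q)) - W (frame P q)‖ₑ ∂jointMeasure
      ≤ ENNReal.ofReal (125 / 56 * ε) * κ := by
  have hm : Measurable fun q =>
      ‖W (frame (deform τ P) (deform τ q)) - W (frame P q)‖ₑ :=
    ((hW.comp (measurable_frame.comp (measurable_const.prodMk hτ.measurable_deform))).sub
      (hW.comp (measurable_frame.comp measurable_prodMk_left))).enorm
  rw [lintegral_prod_symm _ hm.aemeasurable]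
  simp only [frame, deform]
  rw [lintegral_sub_right_eq_self (fun β => ∫⁻ u, ‖W (AddCircle.toCircle P.2 *
    ((u - τ u) - (P.1 - τ P.1)), β) - W (AddCircle.toCircle P.2 * (u - P.1), β)‖ₑ) P.2]
  refine le_trans (le_of_eq ?_) (h.deform_le (fun _ => -AddCircle.toCircle P.2)
    measurable_const (fun β => by rw [norm_neg]; exact norm_toCircle _) P.1)
  simp only [neg_mul, ← mul_neg, neg_sub]

/-- The kernel of the commutator of a joint convolution with the deformation. -/
noncomputable def commutatorKernel (τ : ℂ → ℂ) (W : ℂ × S1 → ℝ) (P q : ℂ × S1) : ℝ :=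
  W (frame P q) - deformJacobian τ q * W (frame (deform τ P) (deform τ q))

lemma measurable_commutatorKernel (hτ : SmallField τ ε) (hW : Measurable W) :
    Measurable fun p : (ℂ × S1) × (ℂ × S1) => commutatorKernel τ W p.1 p.2 :=
  (hW.comp measurable_frame).sub ((hτ.measurable_deformJacobian.comp measurable_snd).mul
    (hW.comp (measurable_frame.comp ((hτ.measurable_deform.comp measurable_fst).prodMk
      (hτ.measurable_deform.comp measurable_snd)))))

/-- With `W'` the deformed filter and `J` the Jacobian, `W - J W' = -J (W' - W) - (J - 1) W`: one
term for the deformation of the filter, one for the change of area. -/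
lemma enorm_commutatorKernel_le (hτ : SmallField τ ε) (P q : ℂ × S1) :
    ‖commutatorKernel τ W P q‖ₑ ≤ ENNReal.ofReal (36 / 25) *
        ‖W (frame (deform τ P) (deform τ q)) - W (frame P q)‖ₑ
      + ENNReal.ofReal (11 / 5 * ε) * ‖W (frame P q)‖ₑ := by
  have e : commutatorKernel τ W P q =
      -(deformJacobian τ q * (W (frame (deform τ P) (deform τ q)) - W (frame P q)))
        - (deformJacobian τ q - 1) * W (frame P q) := by
    unfold commutatorKernel; ring
  rw [e]
  refine enorm_sub_le.trans (add_le_add ?_ ?_)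
  · rw [enorm_neg, enorm_mul]
    refine mul_le_mul_left ?_ _
    rw [← ofReal_norm, deformJacobian, Real.norm_eq_abs, abs_abs]
    exact ENNReal.ofReal_le_ofReal (hτ.abs_det_le q.1)
  · rw [enorm_mul]
    refine mul_le_mul_left ?_ _
    rw [← ofReal_norm, Real.norm_eq_abs]
    exact ENNReal.ofReal_le_ofReal (hτ.abs_abs_det_sub_one_le q.1)

lemma commutator_constant (hε : 0 ≤ ε) :
    ENNReal.ofReal (36 / 25) * (ENNReal.ofReal (125 / 56 * ε) * κ) + ENNReal.ofReal (11 / 5 * ε) * κ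
      = ENNReal.ofReal (379 / 70 * ε) * κ := by
  rw [← mul_assoc, ← ENNReal.ofReal_mul (by norm_num), ← add_mul,
    ← ENNReal.ofReal_add (by positivity) (by positivity)]
  congr 2; ring

lemma lintegral_commutator_row_le (h : FilterBound τ ε W κ) (hτ : SmallField τ ε)
    (hW : Measurable W) (P : ℂ × S1) :
    ∫⁻ q, ‖commutatorKernel τ W P q‖ₑ ∂jointMeasure ≤ ENNReal.ofReal (379 / 70 * ε) * κ := by
  refine (lintegral_mono fun q => enorm_commutatorKernel_le hτ P q).trans ?_
  have hm : Measurable fun q => ENNReal.ofReal (11 / 5 * ε) * ‖W (frame P q)‖ₑ :=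
    (hW.comp (measurable_frame.comp measurable_prodMk_left)).enorm.const_mul _
  rw [lintegral_add_right _ hm, lintegral_const_mul' _ _ ENNReal.ofReal_ne_top,
    lintegral_const_mul' _ _ ENNReal.ofReal_ne_top, ← commutator_constant hτ.nonneg]
  exact add_le_add (mul_le_mul_right (h.lintegral_deform_row_le hτ hW P) _)
    (mul_le_mul_right (h.lintegral_row_le hW P) _)

lemma lintegral_commutator_col_le (h : FilterBound τ ε W κ) (hτ : SmallField τ ε)
    (hW : Measurable W) (q : ℂ × S1) :
    ∫⁻ P, ‖commutatorKernel τ W P q‖ₑ ∂jointMeasure ≤ ENNReal.ofReal (379 / 70 * ε) * κ := by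
  refine (lintegral_mono fun P => enorm_commutatorKernel_le hτ P q).trans ?_
  have hm : Measurable fun P => ENNReal.ofReal (11 / 5 * ε) * ‖W (frame P q)‖ₑ :=
    (hW.comp (measurable_frame.comp measurable_prodMk_right)).enorm.const_mul _
  rw [lintegral_add_right _ hm, lintegral_const_mul' _ _ ENNReal.ofReal_ne_top,
    lintegral_const_mul' _ _ ENNReal.ofReal_ne_top, ← commutator_constant hτ.nonneg]
  exact add_le_add (mul_le_mul_right (h.lintegral_deform_col_le hτ hW q) _)
    (mul_le_mul_right (h.lintegral_col_le hW q) _)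

lemma toReal_ofReal_deformJacobian (τ : ℂ → ℂ) (q : ℂ × S1) :
    (ENNReal.ofReal (deformJacobian τ q)).toReal = deformJacobian τ q :=
  ENNReal.toReal_ofReal (abs_nonneg _)

lemma integral_deform (hτ : SmallField τ ε) {f : ℂ × S1 → ℝ} (hf : Measurable f) :
    ∫ q, deformJacobian τ q * f (deform τ q) ∂jointMeasure = ∫ q, f q ∂jointMeasure := by
  conv_rhs => rw [← hτ.measurePreserving_deform.map_eq]
  rw [integral_map hτ.measurable_deform.aemeasurable hf.aestronglyMeasurable,
    integral_withDensity_eq_integral_toReal_smul hτ.measurable_deformJacobian.ennreal_ofReal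
      (Eventually.of_forall fun q => ENNReal.ofReal_lt_top)]
  refine integral_congr_ae (Eventually.of_forall fun q => ?_)
  simp only [toReal_ofReal_deformJacobian, smul_eq_mul]

lemma integrable_deform (hτ : SmallField τ ε) {f : ℂ × S1 → ℝ} (hf : Measurable f)
    (hfi : Integrable f jointMeasure) :
    Integrable (fun q => deformJacobian τ q * f (deform τ q)) jointMeasure := by
  have h1 := (hτ.measurePreserving_deform.integrable_comp hf.aestronglyMeasurable).2 hfi
  rw [integrable_withDensity_iff_integrable_smul' hτ.measurable_deformJacobian.ennreal_ofReal
      (Eventually.of_forall fun q => ENNReal.ofReal_lt_top)] at h1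
  refine h1.congr (Eventually.of_forall fun q => ?_)
  simp only [toReal_ofReal_deformJacobian, smul_eq_mul, Function.comp]

lemma eLpNorm_commutator_le (h : FilterBound τ ε W κ) (hτ : SmallField τ ε)
    (hW : Measurable W) (hκ : κ ≠ ∞) {x : ℂ × S1 → ℝ} (hx : Measurable x) {c : ℝ}
    (hxc : MemLp (fun q => x q - c) 2 jointMeasure) :
    eLpNorm (fun P => jointConv W (fun q => x (deform τ q)) P - jointConv W x (deform τ P)) 2
        jointMeasure
      ≤ ENNReal.ofReal (8 * ε) * κ * eLpNorm (fun q => x q - c) 2 jointMeasure := by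
  have hxm : Measurable fun q => x q - c := hx.sub_const c
  have hxτ : Measurable fun q => x (deform τ q) := hx.comp hτ.measurable_deform
  have hxcτ := hτ.memLp_comp_deform hxm hxc
  have hWP (P : ℂ × S1) : Measurable fun q => W (frame P q) :=
    hW.comp (measurable_frame.comp measurable_prodMk_left)
  have h1 : eLpNorm (fun P => jointConv W (fun q => x (deform τ q)) P - jointConv W x (deform τ P))
      2 jointMeasure ≤ ENNReal.ofReal (379 / 70 * ε) * κ *
        eLpNorm (fun q => x (deform τ q) - c) 2 jointMeasure := by
    refine eLpNorm_le_of_schur (f := fun q => x (deform τ q) - c) (measurable_commutatorKernel hτ hW).enorm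
      (hxm.comp hτ.measurable_deform) (h.lintegral_commutator_row_le hτ hW)
      (h.lintegral_commutator_col_le hτ hW) ?_
    filter_upwards [h.ae_integrable hW hκ hxτ hxcτ,
      hτ.quasiMeasurePreserving_deform.ae (h.ae_integrable hW hκ hx hxc)] with P i1 i2
    have i3 := h.integrable_const hW hκ c P
    have i4 := h.integrable_const hW hκ c (deform τ P)
    have e1 : jointConv W (fun q => x (deform τ q)) P = c * (∫ p, W p ∂jointMeasure)
        + ∫ q, (x (deform τ q) - c) * W (frame P q) ∂jointMeasure := by
      rw [← jointConv_const W hW c P, jointConv, jointConv, ← sub_eq_iff_eq_add',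
        ← integral_sub i1 i3]
      simp only [sub_mul]
    have e2 : jointConv W x (deform τ P) = c * (∫ p, W p ∂jointMeasure)
        + ∫ q, (x q - c) * W (frame (deform τ P) q) ∂jointMeasure := by
      rw [← jointConv_const W hW c (deform τ P), jointConv, jointConv, ← sub_eq_iff_eq_add',
        ← integral_sub i2 i4]
      simp only [sub_mul]
    have hm : Measurable fun q => (x q - c) * W (frame (deform τ P) q) := hxm.mul (hWP _)
    have i5 : Integrable (fun q => (x q - c) * W (frame (deform τ P) q)) jointMeasure := by
      simp only [sub_mul]; exact i2.sub i4
    have i6 : Integrable (fun q => (x (deform τ q) - c) * W (frame P q)) jointMeasure := by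
      simp only [sub_mul]; exact i1.sub i3
    -- The contributions of the constant cancel. The substitution `q ↦ deform τ q` in the second
    -- integral puts both against the same function `x ∘ deform τ - c`, leaving the commutator
    -- kernel.
    rw [e1, e2, add_sub_add_left_eq_sub, ← integral_deform hτ hm,
      ← integral_sub i6 (integrable_deform hτ hm i5)]
    refine (enorm_integral_le_lintegral_enorm _).trans (le_of_eq (lintegral_congr fun q => ?_))
    rw [← enorm_mul]
    congr 1
    unfold commutatorKernel; ring
  refine h1.trans ?_
  have h2 := hτ.eLpNorm_comp_deform_sq_le hxm
  rw [← ENNReal.pow_le_pow_left_iff two_ne_zero, mul_pow, mul_pow, mul_pow, mul_pow]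
  refine (mul_le_mul_right h2 _).trans (le_of_le_of_eq (b := ENNReal.ofReal (379 / 70 * ε) ^ 2 *
    ENNReal.ofReal (25 / 14) * (κ ^ 2 * eLpNorm (fun q => x q - c) 2 jointMeasure ^ 2))
      (le_of_eq (by ring)) rfl |>.trans ?_)
  rw [mul_assoc (ENNReal.ofReal (8 * ε) ^ 2)]
  refine mul_le_mul_left ?_ _
  have := hτ.nonneg
  rw [← ENNReal.ofReal_pow (by positivity), ← ENNReal.ofReal_pow (by positivity),
    ← ENNReal.ofReal_mul (by positivity)]
  -- The numerical claim is `(379/70)² · 25/14 ≤ 64`; the factor `25/14` is the cost of composing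
  -- with the deformation in squared `L²` norm.
  exact ENNReal.ofReal_le_ofReal (by nlinarith [sq_nonneg ε])

end FilterBound

/-! ### Norms of multi-channel features -/

/-- The channel `i` of a feature as a function on the plane times the circle. -/
def chan {M : ℕ} (x : Feature M) (i : Fin M) (p : ℂ × S1) : ℝ := x p.1 p.2 i

lemma featureNorm_eq (Ω : Set ℂ) {M : ℕ} (x : Feature M) :
    featureNorm Ω x = ((M : ℝ≥0∞)⁻¹ * (volume Ω)⁻¹) ^ (1 / 2 : ℝ) *
      (∑ i, eLpNorm (chan x i) 2 jointMeasure ^ 2) ^ (1 / 2 : ℝ) := by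
  rw [← ENNReal.mul_rpow_of_nonneg _ _ (by norm_num), featureNorm, ← Finset.mul_sum,
    ← mul_assoc]
  simp only [eLpNorm_two_sq, chan]

lemma measurable_chan_sub {M : ℕ} {x y : Feature M} (hx : ∀ i, Measurable (chan x i))
    (hy : ∀ i, Measurable (chan y i)) (i : Fin M) : Measurable (chan (x - y) i) :=
  (hx i).sub (hy i)

lemma featureNorm_zero (Ω : Set ℂ) {M : ℕ} : featureNorm Ω (0 : Feature M) = 0 := by
  simp [featureNorm]

lemma featureNorm_add_le (Ω : Set ℂ) {M : ℕ} {x y : Feature M}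
    (hx : ∀ i, Measurable (chan x i)) (hy : ∀ i, Measurable (chan y i)) :
    featureNorm Ω (x + y) ≤ featureNorm Ω x + featureNorm Ω y := by
  rw [featureNorm_eq, featureNorm_eq, featureNorm_eq, ← mul_add]
  refine mul_le_mul_right ?_ _
  have h1 := ENNReal.Lp_add_le Finset.univ (fun i => eLpNorm (chan x i) 2 jointMeasure)
    (fun i => eLpNorm (chan y i) 2 jointMeasure) (p := 2) (by norm_num)
  simp only [ENNReal.rpow_two] at h1
  refine le_trans (ENNReal.rpow_le_rpow (Finset.sum_le_sum fun i _ => pow_le_pow_left' ?_ 2)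
    (by norm_num)) h1
  exact eLpNorm_add_le (hx i).aestronglyMeasurable (hy i).aestronglyMeasurable (by norm_num)

lemma sq_sum_mul_le {ι : Type*} [Fintype ι] (K f : ι → ℝ≥0∞) :
    (∑ i, K i * f i) ^ 2 ≤ (∑ i, K i) * ∑ i, K i * f i ^ 2 := by
  let _ : MeasurableSpace ι := ⊤
  have h := sq_lintegral_mul_le (μ := (Measure.count : Measure ι)) (K := K) (f := f)
    measurable_from_top measurable_from_top
  simpa only [lintegral_count, tsum_fintype] using h

/-- Schur's test over the channels. -/
lemma featureNorm_le_of_channels (Ω : Set ℂ) {M' M : ℕ} (hM' : 0 < M')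
    {κ : Fin M' → Fin M → ℝ≥0∞} (hrow : ∀ i, ∑ i', κ i' i ≤ 1)
    (hcol : ∀ i', (M' : ℝ≥0∞) / M * ∑ i, κ i' i ≤ 1) {x : Feature M'} {y : Feature M} {D : ℝ≥0∞}
    (h : ∀ i, eLpNorm (chan y i) 2 jointMeasure
      ≤ ∑ i', κ i' i * (D * eLpNorm (chan x i') 2 jointMeasure)) :
    featureNorm Ω y ≤ D * featureNorm Ω x := by
  have hM0 : (M' : ℝ≥0∞) ≠ 0 := by exact_mod_cast hM'.ne'
  have hMt : (M' : ℝ≥0∞) ≠ ∞ := ENNReal.natCast_ne_top _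
  -- The weight `M'/M` in the column condition converts the normalisation `1/M` of the output into
  -- the `1/M'` of the input.
  have hcol' (i' : Fin M') : (M : ℝ≥0∞)⁻¹ * ∑ i, κ i' i ≤ (M' : ℝ≥0∞)⁻¹ := by
    have h1 := mul_le_mul_right (hcol i') (M' : ℝ≥0∞)⁻¹
    rwa [mul_one, div_eq_mul_inv, ← mul_assoc, ← mul_assoc, ENNReal.inv_mul_cancel hM0 hMt,
      one_mul] at h1
  set n : Fin M' → ℝ≥0∞ := fun i' => eLpNorm (chan x i') 2 jointMeasure with hn
  have key : (M : ℝ≥0∞)⁻¹ * ∑ i, eLpNorm (chan y i) 2 jointMeasure ^ 2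
      ≤ D ^ 2 * ((M' : ℝ≥0∞)⁻¹ * ∑ i', n i' ^ 2) := by
    calc _ ≤ (M : ℝ≥0∞)⁻¹ * ∑ i, ∑ i', κ i' i * (D * n i') ^ 2 := by
          refine mul_le_mul_right (Finset.sum_le_sum fun i _ => ?_) _
          refine (pow_le_pow_left' (h i) 2).trans ((sq_sum_mul_le _ _).trans ?_)
          exact (mul_le_mul_left (hrow i) _).trans_eq (one_mul _)
      _ = ∑ i', ((M : ℝ≥0∞)⁻¹ * ∑ i, κ i' i) * (D * n i') ^ 2 := by
          rw [Finset.sum_comm, Finset.mul_sum]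
          refine Finset.sum_congr rfl fun i' _ => ?_
          rw [← Finset.sum_mul, mul_assoc]
      _ ≤ ∑ i', (M' : ℝ≥0∞)⁻¹ * (D * n i') ^ 2 :=
          Finset.sum_le_sum fun i' _ => mul_le_mul_left (hcol' i') _
      _ = _ := by
          rw [← Finset.mul_sum]
          simp only [mul_pow]
          rw [← Finset.mul_sum]; ring
  rw [featureNorm_eq, featureNorm_eq, ← ENNReal.mul_rpow_of_nonneg _ _ (by norm_num),
    ← ENNReal.mul_rpow_of_nonneg _ _ (by norm_num)]
  have hD : D = (D ^ 2) ^ (1 / 2 : ℝ) := by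
    rw [← ENNReal.rpow_natCast, ← ENNReal.rpow_mul]; norm_num
  rw [hD, ← ENNReal.mul_rpow_of_nonneg _ _ (by norm_num)]
  refine ENNReal.rpow_le_rpow ?_ (by norm_num)
  have h2 := mul_le_mul_right key (volume Ω)⁻¹
  calc _ = (volume Ω)⁻¹ * ((M : ℝ≥0∞)⁻¹ * ∑ i, eLpNorm (chan y i) 2 jointMeasure ^ 2) := by ring
    _ ≤ _ := h2
    _ = _ := by ring

/-! ### Layers -/

/-- A joint convolutional layer. -/
noncomputable def convLayer {M' M : ℕ} (σ : ℝ → ℝ) (W : Fin M' → Fin M → ℂ × S1 → ℝ)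
    (b : Fin M → ℝ) (x : Feature M') : Feature M := fun u α i =>
  σ (∑ i', jointConv (W i' i) (chan x i') (u, α) + b i)

/-- A feature with measurable channels, equal to the constants `c` up to functions in `L²`. -/
def Centered {M : ℕ} (x : Feature M) (c : Fin M → ℝ) : Prop :=
  ∀ i, Measurable (chan x i) ∧ MemLp (fun p => chan x i p - c i) 2 jointMeasure

/-- The feature with constant channels. -/
def constFeature {M : ℕ} (c : Fin M → ℝ) : Feature M := fun _ _ i => c i

lemma centered_const {M : ℕ} (c : Fin M → ℝ) : Centered (constFeature c) c := fun i =>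
  ⟨measurable_const, by simp [chan, constFeature]⟩

/-- A bank of measurable filters satisfying bounds which make the layer non-expansive. -/
structure FilterBank (τ : ℂ → ℂ) (ε : ℝ) {M' M : ℕ} (W : Fin M' → Fin M → ℂ × S1 → ℝ)
    (κ : Fin M' → Fin M → ℝ≥0∞) : Prop where
  measurable : ∀ i' i, Measurable (W i' i)
  bound : ∀ i' i, FilterBound τ ε (W i' i) (κ i' i)
  row : ∀ i, ∑ i', κ i' i ≤ 1
  col : ∀ i', (M' : ℝ≥0∞) / M * ∑ i, κ i' i ≤ 1

namespace FilterBank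

variable {τ : ℂ → ℂ} {ε : ℝ} {M' M : ℕ} {W : Fin M' → Fin M → ℂ × S1 → ℝ}
  {κ : Fin M' → Fin M → ℝ≥0∞} {σ : ℝ → ℝ} {b : Fin M → ℝ}

lemma ne_top (h : FilterBank τ ε W κ) (i' : Fin M') (i : Fin M) : κ i' i ≠ ∞ :=
  ((Finset.single_le_sum (f := fun i' => κ i' i) (fun _ _ => zero_le)
    (Finset.mem_univ i')).trans_lt ((h.row i).trans_lt ENNReal.one_lt_top)).ne

lemma measurable_convLayer (h : FilterBank τ ε W κ) (hσ : LipschitzWith 1 σ) {x : Feature M'}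
    (hx : ∀ i, Measurable (chan x i)) (i : Fin M) : Measurable (chan (convLayer σ W b x) i) :=
  hσ.continuous.measurable.comp ((Finset.measurable_fun_sum _ fun i' _ =>
    measurable_jointConv (h.measurable i' i) (hx i')).add_const _)

lemma eLpNorm_le_of_enorm_le_sum {y : ℂ × S1 → ℝ} {f : Fin M' → ℂ × S1 → ℝ}
    (hf : ∀ i, Measurable (f i)) {n : Fin M' → ℝ≥0∞}
    (hn : ∀ i, eLpNorm (f i) 2 jointMeasure ≤ n i) (h : ∀ p, |y p| ≤ |∑ i, f i p|) :
    eLpNorm y 2 jointMeasure ≤ ∑ i, n i := by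
  refine (eLpNorm_mono (g := ∑ i, f i) fun p => ?_).trans ((eLpNorm_sum_le
    (fun i _ => (hf i).aestronglyMeasurable) (by norm_num)).trans
    (Finset.sum_le_sum fun i _ => hn i))
  simpa only [Real.norm_eq_abs, Finset.sum_apply] using h p

lemma abs_sub_le_of_lipschitz (hσ : LipschitzWith 1 σ) (a c : ℝ) : |σ a - σ c| ≤ |a - c| := by
  simpa [Real.dist_eq] using hσ.dist_le_mul a c

lemma eLpNorm_convLayer_sub_le (h : FilterBank τ ε W κ) (hσ : LipschitzWith 1 σ)
    {x y : Feature M'} {c d : Fin M' → ℝ} (hx : Centered x c) (hy : Centered y d) (i : Fin M) :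
    eLpNorm (chan (convLayer σ W b x - convLayer σ W b y) i) 2 jointMeasure
      ≤ ∑ i', κ i' i * (1 * eLpNorm (chan (x - y) i') 2 jointMeasure) := by
  refine eLpNorm_le_of_enorm_le_sum (f := fun i' P => jointConv (W i' i) (chan x i') P
    - jointConv (W i' i) (chan y i') P) (fun i' => (measurable_jointConv (h.measurable i' i)
      (hx i').1).sub (measurable_jointConv (h.measurable i' i) (hy i').1)) (fun i' => ?_)
    fun p => ?_
  · rw [one_mul]
    exact (h.bound i' i).eLpNorm_jointConv_sub_le (h.measurable i' i) (h.ne_top i' i)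
      (hx i').1 (hy i').1 (hx i').2 (hy i').2
  · refine (abs_sub_le_of_lipschitz hσ _ _).trans (le_of_eq ?_)
    rw [Finset.sum_sub_distrib]
    congr 1; ring

lemma featureNorm_convLayer_sub_le (h : FilterBank τ ε W κ) (hσ : LipschitzWith 1 σ) (Ω : Set ℂ)
    (hM' : 0 < M') {x y : Feature M'} {c d : Fin M' → ℝ} (hx : Centered x c) (hy : Centered y d) :
    featureNorm Ω (convLayer σ W b x - convLayer σ W b y) ≤ featureNorm Ω (x - y) :=
  (featureNorm_le_of_channels Ω hM' h.row h.col
    (h.eLpNorm_convLayer_sub_le hσ hx hy)).trans_eq (one_mul _)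

lemma convLayer_const (h : FilterBank τ ε W κ) (c : Fin M' → ℝ) :
    ∃ c' : Fin M → ℝ, convLayer σ W b (constFeature c) = constFeature c' :=
  ⟨fun i => σ (∑ i', c i' * ∫ p, W i' i p ∂jointMeasure + b i), by
    ext u α i
    simp only [convLayer, constFeature]
    congr 2
    exact Finset.sum_congr rfl fun i' _ => jointConv_const _ (h.measurable i' i) _ _⟩

lemma centered_convLayer (h : FilterBank τ ε W κ) (hσ : LipschitzWith 1 σ) {x : Feature M'}
    {c : Fin M' → ℝ} (hx : Centered x c) {c' : Fin M → ℝ}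
    (hc' : convLayer σ W b (constFeature c) = constFeature c') :
    Centered (convLayer σ W b x) c' := fun i => by
  have hm := h.measurable_convLayer (b := b) hσ (fun i' => (hx i').1) i
  refine ⟨hm, (hm.sub_const _).aestronglyMeasurable, ?_⟩
  have h1 := h.eLpNorm_convLayer_sub_le (b := b) hσ hx (centered_const c) i
  rw [hc'] at h1
  refine lt_of_le_of_lt h1 (ENNReal.sum_lt_top.2 fun i' _ => ?_)
  rw [one_mul]
  exact ENNReal.mul_lt_top (h.ne_top i' i).lt_top (hx i').2.2

/-- The nonlinearity acts pointwise and thus commutes with `D_τ`, and the biases cancel, so only the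
commutators of the convolutions remain. -/
lemma featureNorm_commutator_le (h : FilterBank τ ε W κ) (hτ : SmallField τ ε)
    (hσ : LipschitzWith 1 σ) (Ω : Set ℂ) (hM' : 0 < M') {x : Feature M'} {c : Fin M' → ℝ}
    (hx : Centered x c) :
    featureNorm Ω (convLayer σ W b (deformFeature τ x) - deformFeature τ (convLayer σ W b x))
      ≤ ENNReal.ofReal (8 * ε) * featureNorm Ω (x - constFeature c) := by
  refine featureNorm_le_of_channels Ω hM' h.row h.col fun i => ?_
  refine eLpNorm_le_of_enorm_le_sum (f := fun i' P => jointConv (W i' i)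
    (fun q => chan x i' (deform τ q)) P - jointConv (W i' i) (chan x i') (deform τ P))
    (fun i' => (measurable_jointConv (h.measurable i' i)
      ((hx i').1.comp hτ.measurable_deform)).sub
      ((measurable_jointConv (h.measurable i' i) (hx i').1).comp hτ.measurable_deform))
    (fun i' => ?_) fun p => ?_
  · refine ((h.bound i' i).eLpNorm_commutator_le hτ (h.measurable i' i) (h.ne_top i' i)
      (hx i').1 (hx i').2).trans (le_of_eq ?_)
    rw [mul_comm (ENNReal.ofReal _), mul_assoc]; rfl
  · refine (abs_sub_le_of_lipschitz hσ _ _).trans (le_of_eq ?_)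
    rw [Finset.sum_sub_distrib, add_sub_add_right_eq_sub]
    rfl

end FilterBank

/-! ### Rotations -/

/-- The action of a rotation on the plane times the circle. -/
noncomputable def rotMap (u₀ : ℂ) (t : S1) (p : ℂ × S1) : ℂ × S1 := (rotAbout u₀ t p.1, p.2 - t)

lemma measurePreserving_rotMap (u₀ : ℂ) (t : S1) :
    MeasurePreserving (rotMap u₀ t) jointMeasure jointMeasure := by
  have h := (measurePreserving_add_left jointMeasure ((u₀, 0) : ℂ × S1)).comp
    (measurePreserving_frame (u₀, t))
  convert! h using 1
  ext p
  · simp [rotMap, frame, rotAbout, rot]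
  · simp [rotMap, frame]

/-- Relative coordinates do not change when both points undergo the same rigid motion; exact
rotation equivariance of the layers follows. -/
lemma frame_rotMap (u₀ : ℂ) (t : S1) (P q : ℂ × S1) :
    frame (rotMap u₀ t P) (rotMap u₀ t q) = frame P q := by
  unfold frame rotMap rotAbout rot
  refine Prod.ext ?_ (sub_sub_sub_cancel_right _ _ _)
  have : (AddCircle.toCircle P.2 : ℂ) = AddCircle.toCircle (P.2 - t) * AddCircle.toCircle t := by
    rw [← Circle.coe_mul, ← AddCircle.toCircle_add, sub_add_cancel]
  simp only
  rw [this]; ring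

lemma jointConv_rotMap {W x : ℂ × S1 → ℝ} (hW : Measurable W) (hx : Measurable x) (u₀ : ℂ) (t : S1)
    (P : ℂ × S1) :
    jointConv W (fun q => x (rotMap u₀ t q)) P = jointConv W x (rotMap u₀ t P) := by
  have h := measurePreserving_rotMap u₀ t
  have hm : Measurable fun q => x q * W (frame (rotMap u₀ t P) q) :=
    hx.mul (hW.comp (measurable_frame.comp measurable_prodMk_left))
  have h1 := integral_map (μ := jointMeasure) h.measurable.aemeasurable hm.aestronglyMeasurable
  rw [h.map_eq] at h1
  simp only [frame_rotMap] at h1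
  exact h1.symm

lemma convLayer_rotateFeature {M' M : ℕ} (σ : ℝ → ℝ) {W : Fin M' → Fin M → ℂ × S1 → ℝ}
    (hW : ∀ i' i, Measurable (W i' i)) (b : Fin M → ℝ) {x : Feature M'}
    (hx : ∀ i, Measurable (chan x i)) (u₀ : ℂ) (t : S1) :
    convLayer σ W b (rotateFeature u₀ t x) = rotateFeature u₀ t (convLayer σ W b x) := by
  ext u α i
  simp only [convLayer, rotateFeature]
  congr 2
  exact Finset.sum_congr rfl fun i' _ => jointConv_rotMap (hW i' i) (hx i') u₀ t (u, α)

lemma measurable_chan_rotateFeature {M : ℕ} {x : Feature M} (hx : ∀ i, Measurable (chan x i))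
    (u₀ : ℂ) (t : S1) (i : Fin M) : Measurable (chan (rotateFeature u₀ t x) i) :=
  (hx i).comp (measurePreserving_rotMap u₀ t).measurable

lemma featureNorm_rotateFeature (Ω : Set ℂ) (u₀ : ℂ) (t : S1) {M : ℕ} {x : Feature M}
    (hx : ∀ i, Measurable (chan x i)) :
    featureNorm Ω (rotateFeature u₀ t x) = featureNorm Ω x := by
  rw [featureNorm_eq, featureNorm_eq]
  have e (i : Fin M) : chan (rotateFeature u₀ t x) i = chan x i ∘ rotMap u₀ t := rfl
  have h (i : Fin M) : eLpNorm (chan x i ∘ rotMap u₀ t) 2 jointMeasure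
      = eLpNorm (chan x i) 2 jointMeasure :=
    eLpNorm_comp_measurePreserving (hx i).aestronglyMeasurable (measurePreserving_rotMap u₀ t)
  simp only [e, h]

lemma Centered.rotateFeature {M : ℕ} {x : Feature M} {c : Fin M → ℝ} (hx : Centered x c) (u₀ : ℂ)
    (t : S1) : Centered (rotateFeature u₀ t x) c := fun i =>
  ⟨(hx i).1.comp (measurePreserving_rotMap u₀ t).measurable,
    (hx i).2.comp_measurePreserving (measurePreserving_rotMap u₀ t)⟩

lemma Centered.deformFeature {τ : ℂ → ℂ} {ε : ℝ} (hτ : SmallField τ ε) {M : ℕ} {x : Feature M}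
    {c : Fin M → ℝ} (hx : Centered x c) : Centered (deformFeature τ x) c := fun i =>
  ⟨(hx i).1.comp hτ.measurable_deform, hτ.memLp_comp_deform ((hx i).1.sub_const _) (hx i).2⟩

/-- One layer adds at most `8 ε F` to the equivariance error. -/
lemma FilterBank.equivariance_step {τ : ℂ → ℂ} {ε : ℝ} {M' M : ℕ}
    {W : Fin M' → Fin M → ℂ × S1 → ℝ} {κ : Fin M' → Fin M → ℝ≥0∞} (h : FilterBank τ ε W κ)
    (hτ : SmallField τ ε) {σ : ℝ → ℝ} (hσ : LipschitzWith 1 σ) (b : Fin M → ℝ) (Ω : Set ℂ)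
    (hM' : 0 < M') (u₀ : ℂ) (t : S1) {x x' : Feature M'} {c : Fin M' → ℝ}
    (hx : Centered x c) (hx' : Centered x' c) {F B : ℝ≥0∞}
    (hF : featureNorm Ω (x - constFeature c) ≤ F)
    (hB : featureNorm Ω (x' - rotateFeature u₀ t (deformFeature τ x)) ≤ B) :
    ∃ c' : Fin M → ℝ, Centered (convLayer σ W b x) c' ∧ Centered (convLayer σ W b x') c' ∧
      featureNorm Ω (convLayer σ W b x - constFeature c') ≤ F ∧
      featureNorm Ω (convLayer σ W b x' - rotateFeature u₀ t (deformFeature τ (convLayer σ W b x)))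
        ≤ B + ENNReal.ofReal (8 * ε) * F := by
  obtain ⟨c', hc'⟩ := h.convLayer_const (σ := σ) (b := b) c
  have hD := hx.deformFeature hτ
  have hTD := hD.rotateFeature u₀ t
  have hy := h.centered_convLayer hσ hx hc'
  have hy' := h.centered_convLayer hσ hx' hc'
  refine ⟨c', hy, hy', ?_, ?_⟩
  · rw [← hc']
    exact (h.featureNorm_convLayer_sub_le hσ Ω hM' hx (centered_const c)).trans hF
  · set z := convLayer σ W b (deformFeature τ x) with hz
    have hzm := h.measurable_convLayer (b := b) hσ fun i => (hD i).1
    -- The first term propagates the earlier error through a non-expansive layer; the second is the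
    -- rotated commutator of this layer, rotations having been moved outside exactly.
    have e : convLayer σ W b x' - rotateFeature u₀ t (deformFeature τ (convLayer σ W b x))
        = (convLayer σ W b x' - convLayer σ W b (rotateFeature u₀ t (deformFeature τ x)))
          + rotateFeature u₀ t (z - deformFeature τ (convLayer σ W b x)) := by
      rw [convLayer_rotateFeature σ h.measurable b (fun i => (hD i).1)]
      ext u α i
      simp [rotateFeature, hz]
    have hdm (i : Fin M) : Measurable (chan (z - deformFeature τ (convLayer σ W b x)) i) :=
      measurable_chan_sub hzm (fun i => ((hy.deformFeature hτ) i).1) i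
    have hm₁ (i : Fin M) : Measurable (chan (convLayer σ W b x' -
        convLayer σ W b (rotateFeature u₀ t (deformFeature τ x))) i) :=
      measurable_chan_sub (fun i => (hy' i).1) (h.measurable_convLayer hσ fun i => (hTD i).1) i
    have hm₂ (i : Fin M) : Measurable (chan (rotateFeature u₀ t
        (z - deformFeature τ (convLayer σ W b x))) i) :=
      measurable_chan_rotateFeature hdm u₀ t i
    rw [e]
    refine (featureNorm_add_le Ω hm₁ hm₂).trans ?_
    rw [featureNorm_rotateFeature Ω u₀ t hdm]
    exact add_le_add ((h.featureNorm_convLayer_sub_le hσ Ω hM' hx' hTD).trans hB)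
      ((h.featureNorm_commutator_le hτ hσ Ω hM' hx).trans (mul_le_mul_right hF _))

/-! ### The layers of a network as joint convolutions with measurable filters -/

lemma filterBank_of_filterBound_le {τ : ℂ → ℂ} {ε : ℝ} {M' M : ℕ}
    {W : Fin M' → Fin M → ℂ × S1 → ℝ} {c : Fin M' → Fin M → ℝ≥0∞} (hc : filterBound c ≤ 1)
    (hW : ∀ i' i, Measurable (W i' i))
    (hb : ∀ i' i, FilterBound τ ε (W i' i) (ENNReal.ofReal Real.pi * c i' i)) :
    FilterBank τ ε W fun i' i => ENNReal.ofReal Real.pi * c i' i where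
  measurable := hW
  bound := hb
  row i := by
    rw [← Finset.mul_sum]
    refine le_trans (mul_le_mul_right ?_ _) hc
    exact (le_iSup (fun i => ∑ i', c i' i) i).trans (le_max_left _ _)
  col i' := by
    rw [← Finset.mul_sum, mul_left_comm]
    refine le_trans (mul_le_mul_right ?_ _) hc
    exact (le_iSup (fun i' => (M' : ℝ≥0∞) / M * ∑ i, c i' i) i').trans (le_max_right _ _)

namespace RotDCFNet

variable (N : RotDCFNet)

/-- Measurable versions of the filters of the first layer, constant in the angle. -/
noncomputable def filter₁ (i' : Fin (N.M 0)) (i : Fin (N.M 1)) (p : ℂ × S1) : ℝ :=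
  (N.expansion₁ i' i).1.1.mk _ p.1

/-- Measurable versions of the filters of the joint layers. -/
noncomputable def filter (l : ℕ) (i' : Fin (N.M (l + 1))) (i : Fin (N.M (l + 2))) :
    ℂ × S1 → ℝ :=
  (N.expansion l i' i).1.1.mk _

lemma filterBank₁ {τ : ℂ → ℂ} {ε : ℝ} (hτ : SmallField τ ε) (hA : N.A 0 ≤ 1) :
    FilterBank τ ε N.filter₁ fun i' i => ENNReal.ofReal Real.pi * fbNormPlane (N.a₁ i' i) :=
  filterBank_of_filterBound_le hA
    (fun i' i => (N.expansion₁ i' i).1.1.stronglyMeasurable_mk.measurable.comp measurable_fst)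
    fun i' i => (N.expansion₁ i' i).filterBound hτ
      (N.expansion₁ i' i).1.1.stronglyMeasurable_mk.measurable (N.expansion₁ i' i).1.1.ae_eq_mk

lemma filterBank {τ : ℂ → ℂ} {ε : ℝ} (hτ : SmallField τ ε) {l : ℕ} (hA : N.A (l + 1) ≤ 1) :
    FilterBank τ ε (N.filter l) fun i' i => ENNReal.ofReal Real.pi * fbNormJoint (N.a l i' i) :=
  filterBank_of_filterBound_le hA
    (fun i' i => (N.expansion l i' i).1.1.stronglyMeasurable_mk.measurable)
    fun i' i => (N.expansion l i' i).filterBound hτ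
      (N.expansion l i' i).1.1.stronglyMeasurable_mk.measurable (N.expansion l i' i).1.1.ae_eq_mk

/-- The equality holds at every point, although the filter is changed on a null set: for each `(u,
α)` the frame map preserves the measure, so the integrands agree almost everywhere. -/
lemma jointLayer_eq (l : ℕ) (x : Feature (N.M (l + 1))) :
    N.jointLayer l x = convLayer N.σ (N.filter l) (N.b l) x := by
  ext u α i
  simp only [jointLayer, convLayer]
  congr 2
  refine Finset.sum_congr rfl fun i' _ => ?_
  have h := integral_add_left_eq_self (μ := jointMeasure)
    (fun q : ℂ × S1 => x q.1 q.2 i' * N.W l i' i (rot α (q.1 - u)) (q.2 - α)) (u, 0)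
  simp only [Prod.fst_add, Prod.snd_add, zero_add, add_sub_cancel_left] at h
  rw [h]
  refine integral_congr_ae ?_
  filter_upwards [(measurePreserving_frame (u, α)).quasiMeasurePreserving.ae
    (N.expansion l i' i).1.1.ae_eq_mk] with q hq
  exact congrArg (x q.1 q.2 i' * ·) hq

/-- The circle has mass one, so an image viewed as a feature constant in the angle turns the first
layer into a joint convolution. -/
lemma firstLayer_eq {x x' : Image (N.M 0)} (hx : ∀ i, (fun u => x u i) =ᵐ[volume] fun u => x' u i) :
    N.firstLayer x = convLayer N.σ N.filter₁ N.b₁ fun u _ i => x' u i := by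
  ext u α i
  simp only [firstLayer, convLayer]
  congr 2
  refine Finset.sum_congr rfl fun i' _ => ?_
  have h := integral_add_left_eq_self (μ := (volume : Measure ℂ))
    (fun q : ℂ => x q i' * N.W₁ i' i (rot α (q - u))) u
  simp only [add_sub_cancel_left] at h
  have h2 := integral_fun_fst (μ := (volume : Measure ℂ)) (ν := circleMeasure)
    (fun q : ℂ => x q i' * N.W₁ i' i (rot α (q - u)))
  simp only [probReal_univ, one_smul] at h2
  rw [h, ← h2]
  refine integral_congr_ae ?_
  have hq1 := (Measure.quasiMeasurePreserving_fst (μ := (volume : Measure ℂ))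
    (ν := circleMeasure))
  filter_upwards [(hq1.comp (measurePreserving_frame (u, α)).quasiMeasurePreserving).ae
    (N.expansion₁ i' i).1.1.ae_eq_mk, hq1.ae (hx i')] with q hq hqx
  exact congrArg₂ (· * ·) hqx hq

end RotDCFNet

lemma imageNorm_eq_featureNorm (Ω : Set ℂ) {M : ℕ} {x x' : Image M}
    (hx : ∀ i, (fun u => x u i) =ᵐ[volume] fun u => x' u i) (hm : ∀ i, Measurable fun u => x' u i) :
    featureNorm Ω (fun u _ i => x' u i : Feature M) = imageNorm Ω x := by
  unfold featureNorm imageNorm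
  congr 2
  refine Finset.sum_congr rfl fun i _ => ?_
  congr 1
  have h : Measurable fun p : ℂ × S1 => ‖x' p.1 i‖ₑ ^ 2 :=
    ((hm i).comp measurable_fst).enorm.pow_const 2
  refine (lintegral_prod _ h.aemeasurable).trans ?_
  simp only [lintegral_const, measure_univ, mul_one]
  refine lintegral_congr_ae ?_
  filter_upwards [hx i] with u hu
  rw [← show x u i = x' u i from hu]

lemma SmallField.ae_eq_comp_deform {τ : ℂ → ℂ} {ε : ℝ} (hτ : SmallField τ ε) (u₀ : ℂ) (t : S1)
    {f g : ℂ → ℝ} (h : f =ᵐ[volume] g) :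
    (fun u => f (rotAbout u₀ t u - τ (rotAbout u₀ t u))) =ᵐ[volume]
      fun u => g (rotAbout u₀ t u - τ (rotAbout u₀ t u)) := by
  have hq1 := (Measure.quasiMeasurePreserving_fst (μ := (volume : Measure ℂ))
    (ν := circleMeasure))
  have h1 := ((hq1.comp hτ.quasiMeasurePreserving_deform).comp
    (measurePreserving_rotMap u₀ t).quasiMeasurePreserving).ae h
  have h2 : ∀ᵐ p : ℂ × S1 ∂jointMeasure, f (rotAbout u₀ t p.1 - τ (rotAbout u₀ t p.1))
    = g (rotAbout u₀ t p.1 - τ (rotAbout u₀ t p.1)) := h1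
  have h3 := Measure.ae_ae_of_ae_prod h2
  filter_upwards [h3] with u hu
  -- The statement does not involve the angle, and the circle has nonzero measure, so one angle
  -- suffices.
  exact hu.exists.choose_spec

end RotDCF

open RotDCF in
/-- Approximate equivariance at all layers. The index `l : ℕ` stands for the layer `l + 1`, so that
layers `1, …, L` are indexed by `l < L`. -/
theorem proposition3p3
    (N : RotDCFNet)
    (L : ℕ)
    (Ω : Set ℂ) (hΩ : MeasurableSet Ω) (hΩ_pos : volume Ω ≠ 0) (hΩ_fin : volume Ω ≠ ∞)
    (hA1 : LipschitzWith 1 N.σ)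
    (hA2 : ∀ l < L, N.A l ≤ 1)
    (τ : ℂ → ℂ) (hτ : ContDiff ℝ 2 τ)
    (hA3 : gradSup τ < 1 / 5)
    (u₀ : ℂ) (t : S1)
    (x₀ : Image (N.M 0)) (hx₀ : ∀ i, MemLp (fun u => x₀ u i) 2 volume)
    (l : ℕ) (hl : l < L) :
    featureNorm Ω
        (N.output (rotateImage u₀ t (deformImage τ x₀)) l
          - rotateFeature u₀ t (deformFeature τ (N.output x₀ l)))
      ≤ 2 * 4 * ((l + 1 : ℕ) : ℝ≥0∞) * gradSup τ * imageNorm Ω x₀ := by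
  have hfin : gradSup τ ≠ ∞ := (hA3.trans (ENNReal.div_lt_top (by simp) (by simp))).ne
  set ε : ℝ := (gradSup τ).toReal with hε
  have hετ : ENNReal.ofReal ε = gradSup τ := ENNReal.ofReal_toReal hfin
  have hsmall : SmallField τ ε := by
    refine ⟨hτ.of_le (by norm_num), fun u => ?_, ?_⟩
    · rw [← toReal_enorm]
      exact ENNReal.toReal_mono hfin (le_iSup (fun u => ‖fderiv ℝ τ u‖ₑ) u)
    · have := (ENNReal.toReal_lt_toReal hfin (by simp)).2 hA3
      simpa using this
  set x₁ : Image (N.M 0) := fun u i => (hx₀ i).1.mk _ u with hx₁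
  have hx₁m (i : Fin (N.M 0)) : Measurable fun u => x₁ u i :=
    (hx₀ i).1.stronglyMeasurable_mk.measurable
  have hx₁e (i : Fin (N.M 0)) : (fun u => x₀ u i) =ᵐ[volume] fun u => x₁ u i := (hx₀ i).1.ae_eq_mk
  set f : Feature (N.M 0) := fun u _ i => x₁ u i with hf
  have hfc : Centered f 0 := fun i => by
    refine ⟨(hx₁m i).comp measurable_fst, ?_⟩
    have h1 : MemLp (fun u => x₁ u i) 2 volume := (memLp_congr_ae (hx₁e i)).1 (hx₀ i)
    simp only [Pi.zero_apply, sub_zero]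
    exact h1.comp_fst circleMeasure
  have hf0 : featureNorm Ω (f - constFeature 0) ≤ imageNorm Ω x₀ := by
    rw [← imageNorm_eq_featureNorm Ω hx₁e hx₁m,
      show f - constFeature 0 = f by ext; simp [constFeature]]
  have hstart : N.output x₀ 0 = convLayer N.σ N.filter₁ N.b₁ f := N.firstLayer_eq hx₁e
  have hstart' : N.output (rotateImage u₀ t (deformImage τ x₀)) 0
      = convLayer N.σ N.filter₁ N.b₁ (rotateFeature u₀ t (deformFeature τ f)) :=
    N.firstLayer_eq (x' := rotateImage u₀ t (deformImage τ x₁))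
      fun i => hsmall.ae_eq_comp_deform u₀ t (hx₁e i)
  -- The induction carries a constant feature `c` common to both inputs, and the bound of the
  -- centred norm by `‖x⁽⁰⁾‖`; without the latter the commutator error could grow from layer to
  -- layer.
  have key : ∀ l < L, ∃ c : Fin (N.M (l + 1)) → ℝ, Centered (N.output x₀ l) c ∧
      Centered (N.output (rotateImage u₀ t (deformImage τ x₀)) l) c ∧
      featureNorm Ω (N.output x₀ l - constFeature c) ≤ imageNorm Ω x₀ ∧
      featureNorm Ω (N.output (rotateImage u₀ t (deformImage τ x₀)) l
        - rotateFeature u₀ t (deformFeature τ (N.output x₀ l)))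
        ≤ ((l + 1 : ℕ) : ℝ≥0∞) * (ENNReal.ofReal (8 * ε) * imageNorm Ω x₀) := by
    intro l
    induction l with
    | zero =>
      intro hl
      rw [hstart, hstart']
      -- On angle-independent features the actions on layers restrict to those on images, so the
      -- initial error is `B = 0` and the initial constants are `0`.
      have := (N.filterBank₁ hsmall (hA2 0 hl)).equivariance_step hsmall hA1 N.b₁ Ω (N.M_pos 0) u₀ t
        hfc ((hfc.deformFeature hsmall).rotateFeature u₀ t) hf0 (B := 0)
        (by rw [sub_self, featureNorm_zero])
      simpa using this
    | succ l ih =>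
      intro hl
      obtain ⟨c, h1, h2, h3, h4⟩ := ih (by omega)
      have := (N.filterBank hsmall (hA2 (l + 1) hl)).equivariance_step hsmall hA1 (N.b l) Ω
        (N.M_pos (l + 1)) u₀ t h1 h2 h3 h4
      simp only [RotDCFNet.output, N.jointLayer_eq]
      obtain ⟨c', h1, h2, h3, h4⟩ := this
      refine ⟨c', h1, h2, h3, h4.trans_eq ?_⟩
      push_cast
      ring
  obtain ⟨c, -, -, -, h⟩ := key l hl
  refine h.trans_eq ?_
  rw [ENNReal.ofReal_mul (by norm_num), hετ, show ENNReal.ofReal 8 = 2 * 4 by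
    rw [show (8 : ℝ) = 2 * 4 by norm_num, ENNReal.ofReal_mul (by norm_num)]; simp]
  ring
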